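/- For $1\le p\le\infty$ and $\sigma\in\mathbb R$ let $L^{p,\sigma}(\mathbb R^3)$ be the Banach space of (classes of) measurable functions $f:\mathbb R^3\to\mathbb C$ with norm $\|f\|_{L^{p,\sigma}}=\|(1+|\cdot|)^{\sigma}f\|_{L^p(\mathbb R^3)}<\infty$. For $\lambda\in\mathbb R$ let $R_0^{\pm}(\lambda^2)$ denote the boundary values of the free resolvent $(-\Delta-z)^{-1}$ on $\mathbb R^3$, that is, the integral operators $$R_0^{\pm}(\lambda^2)g(x)=\int_{\mathbb R^3}\frac{e^{\pm i\lambda|x-y|}}{4\pi|x-y|}\,g(y)\,dy .$$ Lemma. Let $\varepsilon>0$, let $V\in L^{\frac32(1+\varepsilon)}(\mathbb R^3)\cap L^1(\mathbb R^3)$ be real-valued, and let $\frac{1+\varepsilon}{\varepsilon}\le p\le\infty$ with $p>3$ (the latter is automatic if $\varepsilon<\frac12$). Let $p'$ be the conjugate exponent, $\frac1p+\frac1{p'}=1$. Then for every fixed $\lambda\in\mathbb R$ and each choice of sign, the operator $f\mapsto R_0^{\pm}(\lambda^2)(Vf)$ is a well-defined compact linear operator from $L^{p,-1}(\mathbb R^3)$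 to itself (the defining integral converges absolutely for almost every $x$), and, dually, $g\mapsto V\,R_0^{\mp}(\lambda^2)g$ is a well-defined compact linear operator from $L^{p',1}(\mathbb R^3)$ to itself (again with an integral that converges absolutely for almost every $x$). -/

import Mathlib

open MeasureTheory
open scoped ENNReal

noncomputable section

/-- Three-dimensional Euclidean space, with its Euclidean norm and Lebesgue measure. -/
abbrev E3 : Type := EuclideanSpace ℝ (Fin 3)

/-- The weight `(1 + |x|) ^ σ`, as a complex number. -/
def weight (σ : ℝ) (x : E3) : ℂ := (((1 + ‖x‖) ^ σ : ℝ) : ℂ)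

theorem weight_continuous (σ : ℝ) : Continuous (weight σ) := by
  unfold weight
  refine Complex.continuous_ofReal.comp ?_
  refine Continuous.rpow_const (by fun_prop) fun x => Or.inl ?_
  have := norm_nonneg x
  positivity

theorem weight_ne_zero (σ : ℝ) (x : E3) : weight σ x ≠ 0 := by
  unfold weight
  have := norm_nonneg x
  have h : (0 : ℝ) < (1 + ‖x‖) ^ σ := by positivity
  exact_mod_cast h.ne'

theorem weight_mul_weight_neg (σ : ℝ) (x : E3) : weight σ x * weight (-σ) x = 1 := by
  unfold weight
  have h : (0 : ℝ) < 1 + ‖x‖ := by positivity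
  rw [← Complex.ofReal_mul, ← Real.rpow_add h]
  simp

/-- The a.e.-classes of functions `f` with `(1 + |x|) ^ σ f ∈ L^p`. -/
def weightedLpSubmodule (p : ℝ≥0∞) (σ : ℝ) : Submodule ℂ (E3 →ₘ[volume] ℂ) where
  carrier := {f | MemLp (fun x => weight σ x * f x) p volume}
  zero_mem' := by
    have h : (fun x => weight σ x * (0 : E3 →ₘ[volume] ℂ) x) =ᵐ[volume] (0 : E3 → ℂ) := by
      filter_upwards [AEEqFun.coeFn_zero (α := E3) (μ := volume) (β := ℂ)] with x hx
      simp [hx]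
    exact (memLp_congr_ae h).2 MemLp.zero
  add_mem' := by
    intro f g hf hg
    refine (memLp_congr_ae ?_).2 (MemLp.add hf hg)
    filter_upwards [AEEqFun.coeFn_add f g] with x hx
    simp [hx, mul_add]
  smul_mem' := by
    intro c f hf
    refine (memLp_congr_ae ?_).2 (MemLp.const_smul hf c)
    filter_upwards [AEEqFun.coeFn_smul c f] with x hx
    simp [hx, mul_left_comm]

/-- The weighted Lebesgue space `L^{p,σ}(ℝ³)`. -/
def WeightedLp (p : ℝ≥0∞) (σ : ℝ) : Type := weightedLpSubmodule p σ

namespace WeightedLp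

variable {p : ℝ≥0∞} {σ : ℝ}

instance : AddCommGroup (WeightedLp p σ) :=
  inferInstanceAs (AddCommGroup (weightedLpSubmodule p σ))

instance : Module ℂ (WeightedLp p σ) :=
  inferInstanceAs (Module ℂ (weightedLpSubmodule p σ))

/-- A representative of an element of `L^{p,σ}`. -/
instance : CoeFun (WeightedLp p σ) (fun _ => E3 → ℂ) :=
  ⟨fun f => (f.1 : E3 → ℂ)⟩

theorem memLp (f : WeightedLp p σ) : MemLp (fun x => weight σ x * f x) p volume := f.2

/-- Multiplication by the weight, as a linear map from `L^{p,σ}` to `L^p`. -/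
def toLp (p : ℝ≥0∞) (σ : ℝ) : WeightedLp p σ →ₗ[ℂ] Lp ℂ p (volume : Measure E3) where
  toFun f := (memLp f).toLp
  map_add' f g := by
    rw [← MemLp.toLp_add, MemLp.toLp_eq_toLp_iff]
    filter_upwards [AEEqFun.coeFn_add f.1 g.1] with x hx
    change weight σ x * (f.1 + g.1 : E3 →ₘ[volume] ℂ) x = _
    simp [hx, mul_add]
  map_smul' c f := by
    rw [RingHom.id_apply, ← MemLp.toLp_const_smul, MemLp.toLp_eq_toLp_iff]
    filter_upwards [AEEqFun.coeFn_smul c f.1] with x hx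
    change weight σ x * (c • f.1 : E3 →ₘ[volume] ℂ) x = _
    simp [hx, mul_left_comm]

theorem toLp_injective : Function.Injective (toLp p σ) := by
  intro f g h
  have h' : (memLp f).toLp = (memLp g).toLp := h
  rw [MemLp.toLp_eq_toLp_iff] at h'
  refine Subtype.ext (AEEqFun.ext ?_)
  filter_upwards [h'] with x hx
  exact mul_left_cancel₀ (weight_ne_zero σ x) hx

theorem toLp_surjective : Function.Surjective (toLp p σ) := by
  intro g
  have hm : AEStronglyMeasurable (fun x => weight (-σ) x * g x) (volume : Measure E3) :=
    (weight_continuous _).aestronglyMeasurable.mul (Lp.aestronglyMeasurable g)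
  have hae : (fun x => weight σ x * AEEqFun.mk _ hm x) =ᵐ[volume] g := by
    filter_upwards [AEEqFun.coeFn_mk _ hm] with x hx
    rw [hx, ← mul_assoc, weight_mul_weight_neg, one_mul]
  have hf : MemLp (fun x => weight σ x * AEEqFun.mk _ hm x) p (volume : Measure E3) :=
    (memLp_congr_ae hae).2 (Lp.memLp g)
  refine ⟨⟨AEEqFun.mk _ hm, hf⟩, ?_⟩
  refine Lp.ext ?_
  exact (MemLp.coeFn_toLp hf).trans hae

/-- The norm `‖f‖_{L^{p,σ}} = ‖(1 + |·|) ^ σ f‖_{L^p}`. -/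
instance [Fact (1 ≤ p)] : NormedAddCommGroup (WeightedLp p σ) :=
  NormedAddCommGroup.induced _ _ (toLp p σ) toLp_injective

instance [Fact (1 ≤ p)] : NormedSpace ℂ (WeightedLp p σ) :=
  NormedSpace.induced ℂ _ _ (toLp p σ)

theorem norm_def [Fact (1 ≤ p)] (f : WeightedLp p σ) :
    ‖f‖ = (eLpNorm (fun x => weight σ x * f x) p volume).toReal :=
  Lp.norm_toLp _ (memLp f)

instance [Fact (1 ≤ p)] : CompleteSpace (WeightedLp p σ) := by
  have hi : Isometry (toLp p σ) := AddMonoidHomClass.isometry_of_norm _ fun _ => rfl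
  exact (IsometryEquiv.mk (Equiv.ofBijective _ ⟨toLp_injective, toLp_surjective⟩) hi).completeSpace

end WeightedLp

/-- The kernel `e^{ik|x-y|} / (4π|x-y|)`. For `Im k > 0` it is the integral kernel of
`(-Δ - k²)⁻¹`, where `k` is the square root of `k²` with positive imaginary part. -/
def helmholtzKernel (k : ℂ) (x y : E3) : ℂ :=
  Complex.exp (Complex.I * k * ‖x - y‖) / (4 * Real.pi * ‖x - y‖)

/-- The kernel `e^{± iλ|x-y|} / (4π|x-y|)` of the free resolvent `R₀^±(λ²)` at the boundary
of the spectrum; the sign `±` is `s : ℤˣ`. -/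
def freeResolventKernel (s : ℤˣ) (l : ℝ) (x y : E3) : ℂ :=
  helmholtzKernel (((s : ℤ) : ℂ) * l) x y

/-- `u = R₀^±(λ²) g`: for almost every `x` the integral of the kernel of `R₀^±(λ²)` against `g`
converges absolutely, and its value is `u x`. -/
def IsFreeResolvent (s : ℤˣ) (l : ℝ) (g u : E3 → ℂ) : Prop :=
  ∀ᵐ x : E3, Integrable (fun y => freeResolventKernel s l x y * g y) volume ∧
    u x = ∫ y, freeResolventKernel s l x y * g y

end

/-! Multiplication by the weights turns `R₀ V` on `L^{p,-1}` into the operator on `L^p` with kernel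
`k(x,y) = (1+|x|)⁻¹ R₀(x,y) V(y) (1+|y|)`. Because `R₀(x,y)` is symmetric, the transpose of such a
kernel on `L^{p'}` is the conjugate of `V R₀` on `L^{p',1}`. Both halves therefore follow from one
statement about `k`, expressed by `IsCompactPair`.

The norm that controls both operators at once is the mixed norm `L^p_x(L^{p'}_y)` of the kernel: by
Hölder it bounds the operator on `L^p`, and by Minkowski's integral inequality its transpose on
`L^{p'}`. Compactness survives limits in this norm, so it suffices to approximate `k` by kernels of
finite rank.

The estimate rests on `1+|y| ≤ (1+|x|) + |x-y|`, which gives `(1+|x|)⁻¹ (1+|y|) / |x-y| ≤ 1/|x-y| +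
1/(1+|x|)`. The last term yields a product kernel, finite because `p > 3` and `V ∈ L^{p'}`. The
convolution term is split at `|x-y| = 1` and handled by Young's inequality: the singular part lies
in `L^b` for `b < 3` and is paired with `V` in an exponent above `3/2`; the tail lies in `L^a` for
`a > 3` and is paired with `V` in an exponent below `3/2`. All these exponents for `V` lie between
`1` and `3/2 (1+ε)`.

The approximation cuts `V` off to a ball, then cuts off `x`, then removes the singularity of `R₀`.
What remains is continuous between compactly supported factors, hence a limit of finite-rank kernels
by uniform continuity. The oscillating phase enters only through its modulus and its continuity. -/

/-! ### Integral operators on `L^p` and limits of compact kernels. -/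

/-- The integral operator with kernel `|k|` is bounded on `L^p` with constant `C`. -/
def KernelBound (p : ℝ≥0∞) (k : E3 → E3 → ℂ) (C : ℝ≥0∞) : Prop :=
  ∀ h : E3 → ℂ, Measurable h →
    eLpNorm (fun x => ∫⁻ y, ‖k x y * h y‖ₑ) p volume ≤ C * eLpNorm h p volume

/-- `T` is the integral operator with kernel `k`, given by an absolutely convergent integral. -/
def IsKernelOp (p : ℝ≥0∞) [Fact (1 ≤ p)] (k : E3 → E3 → ℂ)
    (T : Lp ℂ p (volume : Measure E3) →L[ℂ] Lp ℂ p (volume : Measure E3)) : Prop :=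
  ∀ h : Lp ℂ p (volume : Measure E3), ∀ᵐ x, Integrable (fun y => k x y * h y) volume ∧
    T h x = ∫ y, k x y * h y

theorem ae_lt_top_of_eLpNorm_lt_top {p : ℝ≥0∞} (hp : p ≠ 0) {F : E3 → ℝ≥0∞}
    (hF : Measurable F) (h : eLpNorm F p volume < ∞) : ∀ᵐ x, F x < ∞ := by
  by_cases hp' : p = ∞
  · subst hp'
    rw [eLpNorm_exponent_top] at h
    filter_upwards [ae_le_essSup (f := fun x => ‖F x‖ₑ) (μ := volume)] with x hx
    exact lt_of_le_of_lt hx h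
  · have h1 := lintegral_rpow_enorm_lt_top_of_eLpNorm_lt_top hp hp' h
    simp only [enorm_eq_self] at h1
    filter_upwards [ae_lt_top (hF.pow_const _) h1.ne] with x hx
    exact (ENNReal.rpow_lt_top_iff_of_pos (ENNReal.toReal_pos hp hp')).1 hx

theorem measurable_kernel_mul {k : E3 → E3 → ℂ} (hk : Measurable (Function.uncurry k))
    {h : E3 → ℂ} (hh : Measurable h) :
    Measurable (Function.uncurry fun x y => k x y * h y) :=
  hk.mul (hh.comp measurable_snd)

theorem KernelBound.ae_integrable {p : ℝ≥0∞} (hp : p ≠ 0) {k : E3 → E3 → ℂ} {C : ℝ≥0∞}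
    (hk : Measurable (Function.uncurry k)) (hb : KernelBound p k C) (hC : C ≠ ∞)
    {h : E3 → ℂ} (hh : Measurable h) (hhp : eLpNorm h p volume < ∞) :
    ∀ᵐ x, Integrable (fun y => k x y * h y) volume := by
  have hm := measurable_kernel_mul hk hh
  have h1 : eLpNorm (fun x => ∫⁻ y, ‖k x y * h y‖ₑ) p volume < ∞ :=
    lt_of_le_of_lt (hb h hh) (ENNReal.mul_lt_top hC.lt_top hhp)
  have h2 : Measurable fun x => ∫⁻ y, ‖k x y * h y‖ₑ := hm.enorm.lintegral_prod_right'
  filter_upwards [ae_lt_top_of_eLpNorm_lt_top hp h2 h1] with x hx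
  exact ⟨(hm.comp measurable_prodMk_left).aestronglyMeasurable, hx⟩

theorem KernelBound.eLpNorm_integral_le {p : ℝ≥0∞} {k : E3 → E3 → ℂ} {C : ℝ≥0∞}
    (hb : KernelBound p k C) {h : E3 → ℂ} (hh : Measurable h) :
    eLpNorm (fun x => ∫ y, k x y * h y) p volume ≤ C * eLpNorm h p volume :=
  (eLpNorm_mono_enorm fun x => by
    simpa using enorm_integral_le_lintegral_enorm (fun y => k x y * h y)).trans (hb h hh)

theorem KernelBound.memLp_integral {p : ℝ≥0∞} {k : E3 → E3 → ℂ} {C : ℝ≥0∞}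
    (hk : Measurable (Function.uncurry k)) (hb : KernelBound p k C) (hC : C ≠ ∞)
    {h : E3 → ℂ} (hh : Measurable h) (hhp : eLpNorm h p volume < ∞) :
    MemLp (fun x => ∫ y, k x y * h y) p volume :=
  ⟨(measurable_kernel_mul hk hh).stronglyMeasurable.integral_prod_right'.aestronglyMeasurable,
    (hb.eLpNorm_integral_le hh).trans_lt (ENNReal.mul_lt_top hC.lt_top hhp)⟩

section KernelOp

variable {p : ℝ≥0∞} [hp1 : Fact (1 ≤ p)] {k k' : E3 → E3 → ℂ}
  {T T' : Lp ℂ p (volume : Measure E3) →L[ℂ] Lp ℂ p (volume : Measure E3)}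

theorem IsKernelOp.of_bound {C : ℝ≥0∞} (hk : Measurable (Function.uncurry k))
    (hb : KernelBound p k C) (hC : C ≠ ∞) :
    ∃ T : Lp ℂ p (volume : Measure E3) →L[ℂ] Lp ℂ p (volume : Measure E3),
      IsKernelOp p k T ∧ ‖T‖ ≤ C.toReal := by
  have hp0 : p ≠ 0 := (lt_of_lt_of_le zero_lt_one hp1.out).ne'
  have hme (h : Lp ℂ p (volume : Measure E3)) : Measurable h :=
    (Lp.stronglyMeasurable h).measurable
  have hmem (h : Lp ℂ p (volume : Measure E3)) : MemLp (fun x => ∫ y, k x y * h y) p volume :=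
    hb.memLp_integral hk hC (hme h) (Lp.eLpNorm_lt_top h)
  have hint (h : Lp ℂ p (volume : Measure E3)) :=
    hb.ae_integrable hp0 hk hC (hme h) (Lp.eLpNorm_lt_top h)
  let L : Lp ℂ p (volume : Measure E3) →ₗ[ℂ] Lp ℂ p (volume : Measure E3) :=
    { toFun := fun h => (hmem h).toLp
      map_add' := fun f g => by
        rw [← MemLp.toLp_add, MemLp.toLp_eq_toLp_iff]
        filter_upwards [hint f, hint g] with x hf hg
        rw [Pi.add_apply, ← integral_add hf hg]
        refine integral_congr_ae ?_
        filter_upwards [Lp.coeFn_add f g] with y hy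
        rw [hy, Pi.add_apply, mul_add]
      map_smul' := fun c f => by
        rw [RingHom.id_apply, ← MemLp.toLp_const_smul, MemLp.toLp_eq_toLp_iff]
        refine Filter.Eventually.of_forall fun x => ?_
        simp only [Pi.smul_apply]
        rw [← integral_smul]
        refine integral_congr_ae ?_
        filter_upwards [Lp.coeFn_smul c f] with y hy
        rw [hy, Pi.smul_apply, mul_smul_comm] }
  refine ⟨L.mkContinuous C.toReal fun h => ?_, fun h => ?_,
    L.mkContinuous_norm_le ENNReal.toReal_nonneg _⟩
  · change ‖(hmem h).toLp‖ ≤ _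
    rw [Lp.norm_toLp, Lp.norm_def, ← ENNReal.toReal_mul]
    exact ENNReal.toReal_mono (ENNReal.mul_ne_top hC (Lp.eLpNorm_ne_top h))
      (hb.eLpNorm_integral_le (hme h))
  · filter_upwards [hint h, (hmem h).coeFn_toLp] with x hx hx'
    exact ⟨hx, hx'⟩

theorem IsKernelOp.unique (h : IsKernelOp p k T) (h' : IsKernelOp p k T') : T = T' := by
  ext1 f
  refine Lp.ext ?_
  filter_upwards [h f, h' f] with x hx hx'
  rw [hx.2, hx'.2]

theorem IsKernelOp.add (h : IsKernelOp p k T) (h' : IsKernelOp p k' T') :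
    IsKernelOp p (fun x y => k x y + k' x y) (T + T') := by
  intro f
  filter_upwards [h f, h' f, Lp.coeFn_add (T f) (T' f)] with x hx hx' hs
  simp only [add_mul]
  refine ⟨hx.1.add hx'.1, ?_⟩
  rw [integral_add hx.1 hx'.1, ← hx.2, ← hx'.2]
  exact hs

theorem IsKernelOp.sub (h : IsKernelOp p k T) (h' : IsKernelOp p k' T') :
    IsKernelOp p (fun x y => k x y - k' x y) (T - T') := by
  intro f
  filter_upwards [h f, h' f, Lp.coeFn_sub (T f) (T' f)] with x hx hx' hs
  simp only [sub_mul]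
  refine ⟨hx.1.sub hx'.1, ?_⟩
  rw [integral_sub hx.1 hx'.1, ← hx.2, ← hx'.2]
  exact hs

/-- `k` is the kernel of a compact integral operator on `L^p`. -/
def IsCompactKernel (p : ℝ≥0∞) [Fact (1 ≤ p)] (k : E3 → E3 → ℂ) : Prop :=
  ∃ T : Lp ℂ p (volume : Measure E3) →L[ℂ] Lp ℂ p (volume : Measure E3),
    IsKernelOp p k T ∧ IsCompactOperator T

theorem IsCompactKernel.add (h : IsCompactKernel p k) (h' : IsCompactKernel p k') :
    IsCompactKernel p fun x y => k x y + k' x y := by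
  obtain ⟨T, hT, hc⟩ := h
  obtain ⟨T', hT', hc'⟩ := h'
  exact ⟨T + T', hT.add hT', hc.add hc'⟩

/-- Compact operators are closed in operator norm, and a bound on the kernel of a difference bounds
its norm. -/
theorem IsCompactKernel.of_approx (hk : Measurable (Function.uncurry k))
    (H : ∀ η : ℝ≥0∞, 0 < η → ∃ k' : E3 → E3 → ℂ, Measurable (Function.uncurry k') ∧
      IsCompactKernel p k' ∧ KernelBound p (fun x y => k x y - k' x y) η) :
    IsCompactKernel p k := by
  have hsub {k' : E3 → E3 → ℂ} (hk' : Measurable (Function.uncurry k')) :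
      Measurable (Function.uncurry fun x y => k x y - k' x y) := hk.sub hk'
  obtain ⟨T, hT⟩ : ∃ T, IsKernelOp p k T := by
    -- No bound on `k` itself is assumed: one approximation at distance `1` already produces the
    -- operator, as a compact one plus a bounded one.
    obtain ⟨k', hk', ⟨S, hS, -⟩, hb⟩ := H 1 one_pos
    obtain ⟨R, hR, -⟩ := IsKernelOp.of_bound (hsub hk') hb ENNReal.one_ne_top
    refine ⟨R + S, ?_⟩
    simpa using hR.add hS
  refine ⟨T, hT, ?_⟩
  have hT' : T ∈ closure {S : Lp ℂ p (volume : Measure E3) →L[ℂ] Lp ℂ p (volume : Measure E3) |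
      IsCompactOperator S} := by
    refine Metric.mem_closure_iff.2 fun η hη => ?_
    obtain ⟨k', hk', ⟨S, hS, hc⟩, hb⟩ := H (ENNReal.ofReal (η / 2)) (by simpa using hη)
    obtain ⟨R, hR, hn⟩ := IsKernelOp.of_bound (hsub hk') hb ENNReal.ofReal_ne_top
    refine ⟨S, hc, ?_⟩
    rw [dist_eq_norm, (hT.sub hS).unique hR]
    rw [ENNReal.toReal_ofReal (by positivity)] at hn
    linarith
  rwa [isClosed_setOfPred_isCompactOperator.closure_eq] at hT'

end KernelOp

/-! ### Hölder, Minkowski and Young inequalities for mixed norms of kernels. -/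

theorem lintegral_mul_le_eLpNorm_mul_eLpNorm {p q : ℝ≥0∞} (hpq : p.HolderConjugate q)
    {f g : E3 → ℝ≥0∞} (hf : Measurable f) (hg : Measurable g) :
    ∫⁻ x, f x * g x ≤ eLpNorm f p volume * eLpNorm g q volume := by
  have hp := hpq.ne_zero
  have hq := hpq.symm.ne_zero
  have htop : ∀ f g : E3 → ℝ≥0∞, Measurable g →
      ∫⁻ x, f x * g x ≤ eLpNorm f ∞ volume * eLpNorm g 1 volume := by
    intro f g hg
    rw [eLpNorm_exponent_top, eLpNorm_one_eq_lintegral_enorm]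
    simp only [enorm_eq_self]
    rw [← lintegral_const_mul _ hg]
    refine lintegral_mono_ae ?_
    filter_upwards [ae_le_essSup (f := fun x => ‖f x‖ₑ) (μ := volume)] with x hx
    exact mul_le_mul_left hx _
  by_cases hpt : p = ∞
  · have hq1 : q = 1 := (ENNReal.HolderConjugate.eq_top_iff_eq_one p q).1 hpt
    subst hpt hq1
    exact htop f g hg
  by_cases hqt : q = ∞
  · have hq1 : p = 1 := (ENNReal.HolderConjugate.eq_top_iff_eq_one q p).1 hqt
    subst hqt hq1
    simpa only [mul_comm] using htop g f hf
  have h := ENNReal.lintegral_mul_le_Lp_mul_Lq volume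
    (ENNReal.HolderConjugate.toReal_of_ne_top (p := p) (q := q) hpt hqt)
    hf.aemeasurable hg.aemeasurable
  rw [eLpNorm_eq_lintegral_rpow_enorm_toReal hp hpt, eLpNorm_eq_lintegral_rpow_enorm_toReal hq hqt]
  simpa using h

/-- Minkowski's integral inequality, with a weight. -/
theorem lintegral_lintegral_mul_rpow_le {r : ℝ} (hr : 1 ≤ r) {K : E3 → E3 → ℝ≥0∞}
    (hK : Measurable (Function.uncurry K)) {g : E3 → ℝ≥0∞} (hg : Measurable g)
    {m : E3 → ℝ≥0∞} (hm : Measurable m) (hmK : ∀ x, ∫⁻ y, K x y ^ r = m x ^ r)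
    (hfin : ∀ᵐ x, m x < ∞) :
    ∫⁻ y, (∫⁻ x, K x y * g x) ^ r ≤ (∫⁻ x, m x * g x) ^ r := by
  have hr0 : 0 < r := by linarith
  -- The integrand is factored as `K g = (K^r m^{-rσ} g)^{1/r} (m g)^σ`, so that Hölder with
  -- exponents `1/r + σ = 1` leaves a factor whose `y`-integral is at most `m g`, since `r - rσ =
  -- 1`.
  set σ : ℝ := 1 - 1 / r with hσ
  have hσ0 : 0 ≤ σ := by
    rw [hσ, sub_nonneg, div_le_one hr0]
    exact hr
  have hσr : r * σ = r - 1 := by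
    rw [hσ]
    field_simp
  set I : ℝ≥0∞ := ∫⁻ x, m x * g x
  have hKm (y : E3) : Measurable fun x => K x y := hK.comp (measurable_id.prodMk measurable_const)
  have hKm' (x : E3) : Measurable fun y => K x y := hK.comp (measurable_const.prodMk measurable_id)
  have hmeas : Measurable (Function.uncurry fun x y => K x y ^ r * (m x ^ (-(r * σ)) * g x)) :=
    (hK.pow_const r).mul (((hm.comp measurable_fst).pow_const _).mul (hg.comp measurable_fst))
  have hmeas' (y : E3) : Measurable fun x => K x y ^ r * (m x ^ (-(r * σ)) * g x) :=
    ((hKm y).pow_const r).mul ((hm.pow_const _).mul hg)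
  -- The negative power of `m` spoils the factorization where `m = 0`; there the slice `K x`
  -- vanishes almost everywhere, so nothing is lost.
  have hzero : ∀ᵐ y, ∀ᵐ x, m x = 0 → K x y = 0 := by
    rw [← Measure.ae_ae_comm]
    · refine Filter.Eventually.of_forall fun x => ?_
      by_cases hx : m x = 0
      · have h0 : ∫⁻ y, K x y ^ r = 0 := by rw [hmK, hx, ENNReal.zero_rpow_of_pos hr0]
        rw [lintegral_eq_zero_iff ((hKm' x).pow_const r)] at h0
        filter_upwards [h0] with y hy _
        exact (ENNReal.rpow_eq_zero_iff_of_pos hr0).1 hy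
      · exact Filter.Eventually.of_forall fun y h => absurd h hx
    · have h1 : MeasurableSet {z : E3 × E3 | m z.1 = 0} :=
        (hm.comp measurable_fst) (measurableSet_singleton 0)
      have h2 : MeasurableSet {z : E3 × E3 | K z.1 z.2 = 0} := hK (measurableSet_singleton 0)
      convert h1.compl.union h2 using 1
      ext z
      simp [imp_iff_not_or]
  have hpt : ∀ᵐ y, (∫⁻ x, K x y * g x) ^ r ≤
      (∫⁻ x, K x y ^ r * (m x ^ (-(r * σ)) * g x)) * I ^ (σ * r) := by
    filter_upwards [hzero] with y hy
    have h1 : ∫⁻ x, K x y * g x ≤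
        ∫⁻ x, (K x y ^ r * (m x ^ (-(r * σ)) * g x)) ^ (1 / r) * (m x * g x) ^ σ := by
      refine lintegral_mono_ae ?_
      filter_upwards [hy, hfin] with x hx hxt
      by_cases h0 : m x = 0
      · simp [hx h0]
      have e1 : (K x y ^ r) ^ (1 / r) = K x y := by
        rw [← ENNReal.rpow_mul, mul_one_div_cancel hr0.ne', ENNReal.rpow_one]
      have e2 : (m x ^ (-(r * σ))) ^ (1 / r) * m x ^ σ = 1 := by
        rw [← ENNReal.rpow_mul, ← ENNReal.rpow_add _ _ h0 hxt.ne]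
        have : -(r * σ) * (1 / r) + σ = 0 := by field_simp; ring
        rw [this, ENNReal.rpow_zero]
      have e3 : g x ^ (1 / r) * g x ^ σ = g x := by
        rw [← ENNReal.rpow_add_of_nonneg _ _ (by positivity) hσ0, hσ, add_sub_cancel,
          ENNReal.rpow_one]
      rw [ENNReal.mul_rpow_of_nonneg _ _ (by positivity),
        ENNReal.mul_rpow_of_nonneg _ _ (by positivity), ENNReal.mul_rpow_of_nonneg _ _ hσ0, e1]
      calc K x y * g x = K x y * (((m x ^ (-(r * σ))) ^ (1 / r) * m x ^ σ) *
            (g x ^ (1 / r) * g x ^ σ)) := by rw [e2, e3, one_mul]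
        _ ≤ _ := le_of_eq (by ring)
    have h2 := h1.trans (ENNReal.lintegral_mul_norm_pow_le (hmeas' y).aemeasurable
      (hm.mul hg).aemeasurable (by positivity) hσ0 (by rw [hσ]; ring))
    calc (∫⁻ x, K x y * g x) ^ r ≤ _ := ENNReal.rpow_le_rpow h2 hr0.le
      _ = _ := by
        rw [ENNReal.mul_rpow_of_nonneg _ _ hr0.le, ← ENNReal.rpow_mul, ← ENNReal.rpow_mul,
          one_div_mul_cancel hr0.ne', ENNReal.rpow_one]
        rfl
  have hleft : Measurable fun y => ∫⁻ x, K x y ^ r * (m x ^ (-(r * σ)) * g x) :=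
    hmeas.lintegral_prod_left'
  calc ∫⁻ y, (∫⁻ x, K x y * g x) ^ r
      ≤ ∫⁻ y, (∫⁻ x, K x y ^ r * (m x ^ (-(r * σ)) * g x)) * I ^ (σ * r) := lintegral_mono_ae hpt
    _ = (∫⁻ x, ∫⁻ y, K x y ^ r * (m x ^ (-(r * σ)) * g x)) * I ^ (σ * r) := by
      rw [lintegral_mul_const _ hleft, ← lintegral_lintegral_swap hmeas.aemeasurable]
    _ ≤ I * I ^ (σ * r) := by
      refine mul_le_mul_left (lintegral_mono_ae ?_) _
      filter_upwards [hfin] with x hx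
      rw [lintegral_mul_const _ ((hKm' x).pow_const r), hmK, ← mul_assoc]
      refine mul_le_mul_left ?_ _
      by_cases h0 : m x = 0
      · rw [h0, ENNReal.zero_rpow_of_pos hr0, zero_mul]
      · rw [← ENNReal.rpow_add _ _ h0 hx.ne, hσr]
        simp
    _ = I ^ r := by
      nth_rw 1 [← ENNReal.rpow_one I]
      rw [← ENNReal.rpow_add_of_nonneg _ _ zero_le_one (by positivity), mul_comm σ, hσr,
        add_sub_cancel]

/-- The mixed norm of `L^p(L^q)`: first `L^q` in the second variable, then `L^p` in the first. -/
noncomputable def mixedNorm (p q : ℝ≥0∞) (K : E3 → E3 → ℝ≥0∞) : ℝ≥0∞ :=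
  eLpNorm (fun x => eLpNorm (K x) q volume) p volume

theorem mixedNorm_mono {p q : ℝ≥0∞} {K K' : E3 → E3 → ℝ≥0∞} (h : ∀ x y, K x y ≤ K' x y) :
    mixedNorm p q K ≤ mixedNorm p q K' :=
  eLpNorm_mono_enorm fun x => eLpNorm_mono_enorm fun y => h x y

theorem measurable_eLpNorm_left {q : ℝ≥0∞} (hq0 : q ≠ 0) (hq : q ≠ ∞) {K : E3 → E3 → ℝ≥0∞}
    (hK : Measurable (Function.uncurry K)) : Measurable fun x => eLpNorm (K x) q volume := by
  simp only [eLpNorm_eq_lintegral_rpow_enorm_toReal hq0 hq, enorm_eq_self]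
  exact (Measurable.lintegral_prod_right' (hK.pow_const q.toReal)).pow_const _

theorem mixedNorm_add_le {p q : ℝ≥0∞} (hp1 : 1 ≤ p) (hq1 : 1 ≤ q) (hq : q ≠ ∞)
    {K K' : E3 → E3 → ℝ≥0∞} (hK : Measurable (Function.uncurry K))
    (hK' : Measurable (Function.uncurry K')) :
    mixedNorm p q (fun x y => K x y + K' x y) ≤ mixedNorm p q K + mixedNorm p q K' := by
  have hq0 : q ≠ 0 := (lt_of_lt_of_le zero_lt_one hq1).ne'
  refine (eLpNorm_mono_enorm fun x => ?_).trans (eLpNorm_add_le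
    (measurable_eLpNorm_left hq0 hq hK).aestronglyMeasurable
    (measurable_eLpNorm_left hq0 hq hK').aestronglyMeasurable hp1)
  exact eLpNorm_add_le (hK.comp measurable_prodMk_left).aestronglyMeasurable
    (hK'.comp measurable_prodMk_left).aestronglyMeasurable hq1

theorem mixedNorm_mul_le {p q : ℝ≥0∞} {f g : E3 → ℝ≥0∞} (hf : Measurable f) (hg : Measurable g) :
    mixedNorm p q (fun x y => f x * g y) ≤ eLpNorm f p volume * eLpNorm g q volume := by
  rw [mul_comm]
  refine eLpNorm_le_mul_eLpNorm_of_ae_le_mul'' p hf.aestronglyMeasurable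
    (Filter.Eventually.of_forall fun x => ?_)
  simp only [enorm_eq_self]
  rw [mul_comm]
  exact eLpNorm_le_mul_eLpNorm_of_ae_le_mul'' q hg.aestronglyMeasurable
    (Filter.Eventually.of_forall fun y => le_rfl)

theorem mixedNorm_const_mul_le {p q : ℝ≥0∞} (hq0 : q ≠ 0) (hq : q ≠ ∞) (c : ℝ≥0∞)
    {K : E3 → E3 → ℝ≥0∞} (hK : Measurable (Function.uncurry K)) :
    mixedNorm p q (fun x y => c * K x y) ≤ c * mixedNorm p q K :=
  eLpNorm_le_mul_eLpNorm_of_ae_le_mul'' p (measurable_eLpNorm_left hq0 hq hK).aestronglyMeasurable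
    (Filter.Eventually.of_forall fun _ => eLpNorm_le_mul_eLpNorm_of_ae_le_mul'' q
      (hK.comp measurable_prodMk_left).aestronglyMeasurable
      (Filter.Eventually.of_forall fun _ => le_rfl))

/-- Hölder in `y` for each fixed `x`, then the `L^p` norm in `x`. -/
theorem kernelBound_mixedNorm {p q : ℝ≥0∞} (hpq : p.HolderConjugate q) (hq : q ≠ ∞)
    {k : E3 → E3 → ℂ} (hk : Measurable (Function.uncurry k)) :
    KernelBound p k (mixedNorm p q fun x y => ‖k x y‖ₑ) := by
  intro h hh
  have hke : Measurable (Function.uncurry fun x y => ‖k x y‖ₑ) := hk.enorm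
  rw [mul_comm]
  refine eLpNorm_le_mul_eLpNorm_of_ae_le_mul'' p (measurable_eLpNorm_left
    hpq.symm.ne_zero hq hke).aestronglyMeasurable (Filter.Eventually.of_forall fun x => ?_)
  simp only [enorm_eq_self, enorm_mul]
  rw [mul_comm]
  simpa using lintegral_mul_le_eLpNorm_mul_eLpNorm hpq.symm
    (hk.comp measurable_prodMk_left).enorm hh.enorm

/-- Minkowski moves the `L^q` norm in `y` inside the integral over `x`; Hölder in `x` then recovers
the same mixed norm. Finiteness makes the slice norms finite almost everywhere, as Minkowski in the
form above requires. -/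
theorem kernelBound_swap_mixedNorm {p q : ℝ≥0∞} (hpq : p.HolderConjugate q) (hq : q ≠ ∞)
    {k : E3 → E3 → ℂ} (hk : Measurable (Function.uncurry k))
    (hfin : mixedNorm p q (fun x y => ‖k x y‖ₑ) < ∞) :
    KernelBound q (fun x y => k y x) (mixedNorm p q fun x y => ‖k x y‖ₑ) := by
  intro h hh
  have hke : Measurable (Function.uncurry fun x y => ‖k x y‖ₑ) := hk.enorm
  have hq0 := hpq.symm.ne_zero
  have hr : 1 ≤ q.toReal := by
    rw [← ENNReal.toReal_one]
    exact ENNReal.toReal_mono hq hpq.symm.one_le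
  have hr0 : 0 < q.toReal := by linarith
  have hm := measurable_eLpNorm_left hq0 hq hke
  have key := lintegral_lintegral_mul_rpow_le hr hke hh.enorm hm (fun x => by
    rw [eLpNorm_eq_lintegral_rpow_enorm_toReal hq0 hq, ← ENNReal.rpow_mul,
      one_div_mul_cancel hr0.ne', ENNReal.rpow_one]
    rfl) (ae_lt_top_of_eLpNorm_lt_top hpq.ne_zero hm hfin)
  have h2 := lintegral_mul_le_eLpNorm_mul_eLpNorm hpq hm hh.enorm
  rw [eLpNorm_eq_lintegral_rpow_enorm_toReal hq0 hq]
  simp only [enorm_eq_self, enorm_mul]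
  rw [one_div, ENNReal.rpow_inv_le_iff hr0]
  refine key.trans (ENNReal.rpow_le_rpow ?_ hr0.le)
  simpa [mixedNorm] using h2

theorem lintegral_mul_mul_rpow_le {a b c : ℝ} (ha : 0 ≤ a) (hb : 0 ≤ b) (hc : 0 ≤ c)
    (habc : a + b + c = 1) {f g h : E3 → ℝ≥0∞} (hf : Measurable f) (hg : Measurable g)
    (hh : Measurable h) :
    ∫⁻ x, f x ^ a * g x ^ b * h x ^ c ≤
      (∫⁻ x, f x) ^ a * (∫⁻ x, g x) ^ b * (∫⁻ x, h x) ^ c := by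
  have := ENNReal.lintegral_prod_norm_pow_le (μ := (volume : Measure E3)) Finset.univ
    (f := ![f, g, h]) (p := ![a, b, c])
    (by intro i _; fin_cases i; exacts [hf.aemeasurable, hg.aemeasurable, hh.aemeasurable])
    (by simpa [Fin.sum_univ_three] using habc)
    (by intro i _; fin_cases i; exacts [ha, hb, hc])
  simpa [Fin.prod_univ_three] using this

/-- Young's convolution inequality, in the form of a bound for the mixed norm of the kernel. -/
theorem mixedNorm_young_le {p q : ℝ≥0∞} (hpq : p.HolderConjugate q) (hq : q ≠ ∞) {α β : ℝ}
    (hαβ : α + β = 1) (hα : p⁻¹.toReal ≤ α) (hβ : p⁻¹.toReal ≤ β) {X Y : E3 → ℝ≥0∞}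
    (hX : Measurable X) (hY : Measurable Y) :
    mixedNorm p q (fun x y => X y ^ α * Y (x - y) ^ β) ≤
      (∫⁻ x, X x) ^ α * (∫⁻ x, Y x) ^ β := by
  have hq0 := hpq.symm.ne_zero
  set t : ℝ := p⁻¹.toReal with ht
  set r : ℝ := q.toReal with hrdef
  have ht0 : 0 ≤ t := ENNReal.toReal_nonneg
  have hr0 : 0 < r := ENNReal.toReal_pos hq0 hq
  -- With `t = 1/p` and `r = q`, these are the three exponents of Hölder's inequality applied to
  -- `X(y) Y(x-y)`, `X(y)` and `Y(x-y)`. They are nonnegative exactly because `α, β ≥ 1/p`.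
  have htr : t * r + (α - t) * r + (β - t) * r = 1 := by
    have h1 : t + r⁻¹ = 1 := by
      have h := hpq.inv_add_inv_eq_one
      have h' := congrArg ENNReal.toReal h
      rwa [ENNReal.toReal_add (ENNReal.inv_ne_top.2 hpq.ne_zero) (ENNReal.inv_ne_top.2 hq0),
        ENNReal.toReal_inv q, ENNReal.toReal_one] at h'
    have h2 : t * r + (α - t) * r + (β - t) * r = (1 - t) * r := by
      linear_combination r * hαβ
    rw [h2, show 1 - t = r⁻¹ by linarith, inv_mul_cancel₀ hr0.ne']
  set A := ∫⁻ x, X x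
  set B := ∫⁻ x, Y x
  have hYx (x : E3) : Measurable fun y => Y (x - y) := hY.comp (measurable_const.sub measurable_id)
  have hB (x : E3) : ∫⁻ y, Y (x - y) = B := lintegral_sub_left_eq_self Y x
  have hXY : Measurable (Function.uncurry fun x y => X y * Y (x - y)) :=
    (hX.comp measurable_snd).mul (hY.comp (measurable_fst.sub measurable_snd))
  set J : E3 → ℝ≥0∞ := fun x => ∫⁻ y, X y * Y (x - y) with hJ
  have hJm : Measurable J := hXY.lintegral_prod_right'
  have hJI : ∫⁻ x, J x = A * B := by
    rw [hJ, lintegral_lintegral_swap hXY.aemeasurable, ← lintegral_mul_const _ hX]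
    refine lintegral_congr fun y => ?_
    rw [lintegral_const_mul _ (show Measurable fun x => Y (x - y) from
        hY.comp (measurable_id.sub measurable_const)),
      lintegral_sub_right_eq_self]
  set c := A ^ (α - t) * B ^ (β - t) with hc
  have hin (x : E3) : eLpNorm (fun y => X y ^ α * Y (x - y) ^ β) q volume ≤ c * J x ^ t := by
    rw [eLpNorm_eq_lintegral_rpow_enorm_toReal hq0 hq, one_div, ENNReal.rpow_inv_le_iff hr0]
    simp only [enorm_eq_self]
    rw [← hrdef]
    have h1 (y : E3) : (X y ^ α * Y (x - y) ^ β) ^ r =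
        (X y * Y (x - y)) ^ (t * r) * X y ^ ((α - t) * r) * Y (x - y) ^ ((β - t) * r) := by
      rw [ENNReal.mul_rpow_of_nonneg _ _ hr0.le, ← ENNReal.rpow_mul, ← ENNReal.rpow_mul,
        ENNReal.mul_rpow_of_nonneg _ _ (by positivity),
        show α * r = t * r + (α - t) * r by ring, show β * r = t * r + (β - t) * r by ring,
        ENNReal.rpow_add_of_nonneg _ _ (by positivity) (mul_nonneg (by linarith) hr0.le),
        ENNReal.rpow_add_of_nonneg _ _ (by positivity) (mul_nonneg (by linarith) hr0.le)]
      ring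
    simp only [h1]
    refine (lintegral_mul_mul_rpow_le (by positivity) (mul_nonneg (by linarith) hr0.le)
      (mul_nonneg (by linarith) hr0.le) htr (hX.mul (hYx x)) hX (hYx x)).trans (le_of_eq ?_)
    rw [hB, hc, ENNReal.mul_rpow_of_nonneg _ _ hr0.le, ENNReal.mul_rpow_of_nonneg _ _ hr0.le,
      ← ENNReal.rpow_mul, ← ENNReal.rpow_mul, ← ENNReal.rpow_mul]
    change J x ^ (t * r) * A ^ ((α - t) * r) * B ^ ((β - t) * r) = _
    ring
  -- Only the convolution `J` still depends on `x`, and `‖J^{1/p}‖_p = (∫ J)^{1/p}`. For `p = ∞` the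
  -- exponent `t` is `0` and the function is constantly `1`.
  have hout : eLpNorm (fun x => J x ^ t) p volume ≤ (A * B) ^ t := by
    by_cases hp : p = ∞
    · have : t = 0 := by rw [ht, hp]; simp
      simp only [this, ENNReal.rpow_zero]
      rw [hp, eLpNorm_exponent_top]
      exact essSup_le_of_ae_le _ (Filter.Eventually.of_forall fun x => by simp)
    · have hp0 : 0 < p.toReal := ENNReal.toReal_pos hpq.ne_zero hp
      have htp : t = p.toReal⁻¹ := ENNReal.toReal_inv p
      rw [eLpNorm_eq_lintegral_rpow_enorm_toReal hpq.ne_zero hp]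
      simp only [enorm_eq_self, ← ENNReal.rpow_mul, htp, inv_mul_cancel₀ hp0.ne', ENNReal.rpow_one]
      rw [hJI, one_div]
  calc mixedNorm p q (fun x y => X y ^ α * Y (x - y) ^ β)
      ≤ c * eLpNorm (fun x => J x ^ t) p volume :=
        eLpNorm_le_mul_eLpNorm_of_ae_le_mul'' p (hJm.pow_const t).aestronglyMeasurable
          (Filter.Eventually.of_forall hin)
    _ ≤ c * (A * B) ^ t := by gcongr
    _ = A ^ α * B ^ β := by
      rw [hc, ENNReal.mul_rpow_of_nonneg _ _ ht0]
      conv_rhs => rw [show α = (α - t) + t by ring, show β = (β - t) + t by ring,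
        ENNReal.rpow_add_of_nonneg _ _ (by linarith) ht0,
        ENNReal.rpow_add_of_nonneg _ _ (by linarith) ht0]
      ring

/-! ### Finite-rank kernels, and compactness of a kernel together with its transpose. -/

theorem KernelBound.mono {p : ℝ≥0∞} {k : E3 → E3 → ℂ} {C C' : ℝ≥0∞} (h : KernelBound p k C)
    (hC : C ≤ C') : KernelBound p k C' := fun f hf => (h f hf).trans (mul_le_mul_left hC _)

theorem isCompactOperator_of_range_le {E F : Type*} [NormedAddCommGroup E] [NormedSpace ℂ E]
    [NormedAddCommGroup F] [NormedSpace ℂ F] (T : E →L[ℂ] F) (W : Submodule ℂ F)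
    [FiniteDimensional ℂ W] (h : ∀ x, T x ∈ W) : IsCompactOperator T := by
  have : ProperSpace W := FiniteDimensional.proper ℂ W
  exact (isCompactOperator_of_locallyCompactSpace_dom (T.codRestrict W h)).clm_comp W.subtypeL

/-- The operator has rank at most one: its range lies in the span of `a`. -/
theorem isCompactKernel_mul {p q : ℝ≥0∞} [Fact (1 ≤ p)] (hpq : p.HolderConjugate q)
    {a b : E3 → ℂ} (ha : Measurable a) (hap : MemLp a p volume) (hb : Measurable b)
    (hbq : MemLp b q volume) : IsCompactKernel p fun x y => a x * b y := by
  have hk : Measurable (Function.uncurry fun x y => a x * b y) :=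
    (ha.comp measurable_fst).mul (hb.comp measurable_snd)
  have hbound : KernelBound p (fun x y => a x * b y)
      (eLpNorm b q volume * eLpNorm a p volume) := by
    intro h hh
    have h1 : ∀ x, ∫⁻ y, ‖a x * b y * h y‖ₑ ≤
        eLpNorm b q volume * eLpNorm h p volume * ‖a x‖ₑ := by
      intro x
      simp only [enorm_mul, mul_assoc]
      rw [lintegral_const_mul _ (show Measurable fun y => ‖b y‖ₑ * ‖h y‖ₑ from
        hb.enorm.mul hh.enorm), mul_comm, ← mul_assoc]
      refine mul_le_mul_left ?_ _
      have := lintegral_mul_le_eLpNorm_mul_eLpNorm hpq.symm hb.enorm hh.enorm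
      simpa using this
    refine (eLpNorm_le_mul_eLpNorm_of_ae_le_mul'' p ha.aestronglyMeasurable
      (Filter.Eventually.of_forall h1)).trans (le_of_eq (by ring))
  obtain ⟨T, hT, -⟩ := IsKernelOp.of_bound hk hbound
    (ENNReal.mul_ne_top hbq.eLpNorm_ne_top hap.eLpNorm_ne_top)
  refine ⟨T, hT, isCompactOperator_of_range_le T (Submodule.span ℂ {hap.toLp}) fun h => ?_⟩
  refine Submodule.mem_span_singleton.2 ⟨∫ y, b y * h y, Lp.ext ?_⟩
  filter_upwards [hT h, Lp.coeFn_smul (∫ y, b y * h y) hap.toLp, hap.coeFn_toLp] with x h1 h2 h3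
  rw [h1.2, h2, Pi.smul_apply, h3, smul_eq_mul, mul_comm, ← integral_const_mul]
  simp only [mul_assoc]

/-- The integral operator with kernel `k` on `L^p` and its transpose on `L^q` are compact. -/
def IsCompactPair (p q : ℝ≥0∞) [Fact (1 ≤ p)] [Fact (1 ≤ q)] (k : E3 → E3 → ℂ) : Prop :=
  Measurable (Function.uncurry k) ∧ IsCompactKernel p k ∧ IsCompactKernel q fun x y => k y x

section

variable {p q : ℝ≥0∞} [Fact (1 ≤ p)] [Fact (1 ≤ q)]

theorem IsCompactPair.add {k k' : E3 → E3 → ℂ} (h : IsCompactPair p q k)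
    (h' : IsCompactPair p q k') : IsCompactPair p q fun x y => k x y + k' x y :=
  ⟨h.1.add h'.1, h.2.1.add h'.2.1, h.2.2.add h'.2.2⟩

theorem isCompactPair_mul (hpq : p.HolderConjugate q)
    {a b : E3 → ℂ} (ha : Measurable a) (hap : MemLp a p volume) (hb : Measurable b)
    (hbq : MemLp b q volume) : IsCompactPair p q fun x y => a x * b y := by
  refine ⟨(ha.comp measurable_fst).mul (hb.comp measurable_snd),
    isCompactKernel_mul hpq ha hap hb hbq, ?_⟩
  simpa only [mul_comm] using isCompactKernel_mul hpq.symm hb hbq ha hap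

theorem isCompactPair_sum (hpq : p.HolderConjugate q) {ι : Type*} (s : Finset ι)
    {k : ι → E3 → E3 → ℂ} (h : ∀ i ∈ s, IsCompactPair p q (k i)) :
    IsCompactPair p q fun x y => ∑ i ∈ s, k i x y := by
  classical
  induction s using Finset.induction_on with
  | empty =>
    simpa using isCompactPair_mul (p := p) (q := q) hpq (a := fun _ => 0) (b := fun _ => 0)
      measurable_const MemLp.zero' measurable_const MemLp.zero'
  | insert i s hi ih =>
    simp only [Finset.sum_insert hi]
    exact (h i (Finset.mem_insert_self i s)).add
      (ih fun j hj => h j (Finset.mem_insert_of_mem hj))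

theorem IsCompactPair.of_approx (hpq : p.HolderConjugate q) (hq : q ≠ ∞) {k : E3 → E3 → ℂ}
    (hk : Measurable (Function.uncurry k))
    (H : ∀ η : ℝ≥0∞, 0 < η → ∃ k' : E3 → E3 → ℂ, IsCompactPair p q k' ∧
      mixedNorm p q (fun x y => ‖k x y - k' x y‖ₑ) ≤ η) :
    IsCompactPair p q k := by
  refine ⟨hk, .of_approx hk fun η hη => ?_, .of_approx (hk.comp measurable_swap) fun η hη => ?_⟩
  · obtain ⟨k', hk', hn⟩ := H η hη
    exact ⟨k', hk'.1, hk'.2.1, (kernelBound_mixedNorm hpq hq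
      (k := fun x y => k x y - k' x y) (hk.sub hk'.1)).mono hn⟩
  -- The minimum with `1` secures a finite mixed norm even when `η = ∞`.
  · obtain ⟨k', hk', hn⟩ := H (min η 1) (lt_min hη one_pos)
    refine ⟨fun x y => k' y x, hk'.1.comp measurable_swap, hk'.2.2, ?_⟩
    exact (kernelBound_swap_mixedNorm hpq hq (k := fun x y => k x y - k' x y) (hk.sub hk'.1)
      ((hn.trans (min_le_right _ _)).trans_lt ENNReal.one_lt_top)).mono
      (hn.trans (min_le_left _ _))

theorem exists_simpleFunc_dist_lt {K : Set E3} (hK : IsCompact K) {δ : ℝ} (hδ : 0 < δ) :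
    ∃ P : SimpleFunc E3 E3, ∀ x ∈ K, dist (P x) x < δ := by
  obtain ⟨t, ht⟩ := hK.elim_finite_subcover (fun n => Metric.ball (TopologicalSpace.denseSeq E3 n) δ)
    (fun n => Metric.isOpen_ball) (fun x _ => by
      obtain ⟨n, hn⟩ := (TopologicalSpace.denseRange_denseSeq E3).exists_dist_lt x hδ
      exact Set.mem_iUnion.2 ⟨n, hn⟩)
  refine ⟨SimpleFunc.nearestPt (TopologicalSpace.denseSeq E3) (t.sup id), fun x hx => ?_⟩
  obtain ⟨n, hn, hxn⟩ := Set.mem_iUnion₂.1 (ht hx)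
  have h := SimpleFunc.edist_nearestPt_le (TopologicalSpace.denseSeq E3) x
    (Finset.le_sup (f := id) hn)
  rw [edist_dist, edist_dist, ENNReal.ofReal_le_ofReal_iff dist_nonneg] at h
  exact h.trans_lt (by rwa [dist_comm])

/-- Replacing `x` in `F` by a nearby point from a finite set gives a finite-rank kernel. Uniform
continuity of `F` on compact sets makes the error at most `ε |a(x)| |b(y)|`, a product kernel of
small mixed norm. -/
theorem isCompactPair_of_continuous (hpq : p.HolderConjugate q) (hq : q ≠ ∞)
    {F : E3 → E3 → ℂ} (hF : Continuous (Function.uncurry F)) {a b : E3 → ℂ}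
    (ha : Measurable a) (hap : MemLp a p volume) (hb : Measurable b) (hbq : MemLp b q volume)
    {R : ℝ} (haR : ∀ x, R < ‖x‖ → a x = 0) (hbR : ∀ x, R < ‖x‖ → b x = 0) :
    IsCompactPair p q fun x y => a x * F x y * b y := by
  refine .of_approx hpq hq (((ha.comp measurable_fst).mul hF.measurable).mul
    (hb.comp measurable_snd)) fun η hη => ?_
  obtain ⟨ε, hε, hεη⟩ : ∃ ε : ℝ, 0 < ε ∧
      ENNReal.ofReal ε * (eLpNorm a p volume * eLpNorm b q volume) ≤ η := by
    have hC := ENNReal.mul_ne_top hap.eLpNorm_ne_top hbq.eLpNorm_ne_top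
    obtain ⟨ε, hε, h⟩ := ENNReal.exists_nnreal_pos_mul_lt hC hη.ne'
    exact ⟨ε, hε, by simpa using h.le⟩
  -- The radius `R + 1` leaves room for `P x`, which lies within distance `1` of `x` but possibly
  -- outside the ball of radius `R`.
  have hcpt : IsCompact (Metric.closedBall (0 : E3) (R + 1) ×ˢ Metric.closedBall (0 : E3) R) :=
    (isCompact_closedBall _ _).prod (isCompact_closedBall _ _)
  obtain ⟨δ, hδ, hFδ⟩ := Metric.uniformContinuousOn_iff.1
    (hcpt.uniformContinuousOn_of_continuous hF.continuousOn) ε hε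
  obtain ⟨P, hP⟩ := exists_simpleFunc_dist_lt (isCompact_closedBall (0 : E3) R)
    (lt_min hδ one_pos)
  have hsum : ∀ x y, ∑ c ∈ P.range, (P ⁻¹' {c}).indicator a x * (F c y * b y) =
      a x * F (P x) y * b y := by
    intro x y
    rw [Finset.sum_eq_single_of_mem (P x) (P.mem_range_self x)]
    · rw [Set.indicator_of_mem (by simp), mul_assoc]
    · intro c _ hc
      rw [Set.indicator_of_notMem (by simpa using hc.symm), zero_mul]
  refine ⟨fun x y => a x * F (P x) y * b y, ?_, ?_⟩
  · simp only [← hsum]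
    refine isCompactPair_sum hpq _ fun c _ => isCompactPair_mul hpq
      (ha.indicator (P.measurableSet_preimage _)) (hap.indicator (P.measurableSet_preimage _))
      ((hF.comp (continuous_const.prodMk continuous_id)).measurable.mul hb) ?_
    have hFc : Continuous fun y => F c y := hF.comp (continuous_const.prodMk continuous_id)
    obtain ⟨C, hC⟩ := (isCompact_closedBall (0 : E3) R).exists_bound_of_continuousOn
      hFc.continuousOn
    refine hbq.of_le_mul (c := C) (hFc.measurable.mul hb).aestronglyMeasurable
      (Filter.Eventually.of_forall fun y => ?_)
    rw [norm_mul]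
    by_cases hy : ‖y‖ ≤ R
    · exact mul_le_mul_of_nonneg_right (hC y (by simpa using hy)) (norm_nonneg _)
    · simp [hbR y (not_le.1 hy)]
  · have hpt : ∀ x y, ‖a x * F x y * b y - a x * F (P x) y * b y‖ₑ ≤
        (ENNReal.ofReal ε * ‖a x‖ₑ) * ‖b y‖ₑ := by
      intro x y
      by_cases hx : ‖x‖ ≤ R
      swap
      · simp [haR x (not_le.1 hx)]
      by_cases hy : ‖y‖ ≤ R
      swap
      · simp [hbR y (not_le.1 hy)]
      have hxP := hP x (by simpa using hx)
      have h1 : dist (F x y) (F (P x) y) < ε := by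
        refine hFδ (x, y) ⟨?_, by simpa using hy⟩ (P x, y) ⟨?_, by simpa using hy⟩ ?_
        · simp only [Metric.mem_closedBall, dist_zero_right]
          linarith
        · simp only [Metric.mem_closedBall, dist_zero_right]
          have h2 := norm_le_norm_add_norm_sub' (P x) x
          rw [← dist_eq_norm] at h2
          have := hxP.trans_le (min_le_right _ _)
          linarith
        · rw [Prod.dist_eq]
          simp only [dist_self]
          rw [dist_comm]
          exact max_lt (hxP.trans_le (min_le_left _ _)) hδ
      rw [show a x * F x y * b y - a x * F (P x) y * b y =
        (F x y - F (P x) y) * a x * b y by ring, enorm_mul, enorm_mul]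
      gcongr
      rw [← ofReal_norm, ← dist_eq_norm]
      exact ENNReal.ofReal_le_ofReal h1.le
    refine (mixedNorm_mono hpt).trans
      ((mixedNorm_mul_le (measurable_const.mul ha.enorm) hb.enorm).trans (le_trans ?_ hεη))
    rw [← mul_assoc]
    refine mul_le_mul' ?_ (le_of_eq ?_)
    · exact eLpNorm_le_mul_eLpNorm_of_ae_le_mul'' p ha.aestronglyMeasurable
        (Filter.Eventually.of_forall fun _ => le_rfl)
    · simp [eLpNorm_enorm]

end

/-! ### Integrability of the potential and of the two pieces of `1/|z|`. -/

/-- This is continuity from above of the finite measure with density `|f|^a`. -/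
theorem tendsto_eLpNorm_indicator_zero {a : ℝ≥0∞} (ha0 : a ≠ 0) (ha : a ≠ ∞) {f : E3 → ℝ≥0∞}
    (hf : eLpNorm f a volume < ∞) {S : ℕ → Set E3} (hS : ∀ n, MeasurableSet (S n))
    (hanti : Antitone S) (hnull : volume (⋂ n, S n) = 0) :
    Filter.Tendsto (fun n => eLpNorm ((S n).indicator f) a volume) Filter.atTop (nhds 0) := by
  have hfin := lintegral_rpow_enorm_lt_top_of_eLpNorm_lt_top ha0 ha hf
  have har := ENNReal.toReal_pos ha0 ha
  set ν := (volume : Measure E3).withDensity fun x => ‖f x‖ₑ ^ a.toReal with hν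
  have hfinν : IsFiniteMeasure ν := isFiniteMeasure_withDensity hfin.ne
  have h1 : Filter.Tendsto (fun n => ν (S n)) Filter.atTop (nhds (ν (⋂ n, S n))) :=
    tendsto_measure_iInter_atTop (fun n => (hS n).nullMeasurableSet) hanti
      ⟨0, measure_ne_top ν _⟩
  rw [(withDensity_absolutelyContinuous _ _) hnull] at h1
  have h2 := ((ENNReal.continuous_rpow_const (y := 1 / a.toReal)).tendsto 0).comp h1
  rw [ENNReal.zero_rpow_of_pos (by positivity)] at h2
  refine h2.congr fun n => ?_
  rw [eLpNorm_indicator_eq_eLpNorm_restrict (hS n), eLpNorm_eq_lintegral_rpow_enorm_toReal ha0 ha]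
  simp only [Function.comp_apply, hν, withDensity_apply _ (hS n)]

/-- Pointwise `|V|^r ≤ |V| + |V|^Q`, according to whether `|V|` is below or above `1`. -/
theorem memLp_of_one_of_exponent_le {V : E3 → ℂ} {Q r : ℝ≥0∞} (h1 : MemLp V 1 volume)
    (hQ : MemLp V Q volume) (hQt : Q ≠ ∞) (hr : 1 ≤ r) (hrQ : r ≤ Q) : MemLp V r volume := by
  have hrt : r ≠ ∞ := ne_top_of_le_ne_top hQt hrQ
  have hr0 : r ≠ 0 := (lt_of_lt_of_le zero_lt_one hr).ne'
  have hQ0 : Q ≠ 0 := (lt_of_lt_of_le zero_lt_one (hr.trans hrQ)).ne'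
  have hr1 : 1 ≤ r.toReal := by
    rw [← ENNReal.toReal_one]
    exact ENNReal.toReal_mono hrt hr
  have hrQ' : r.toReal ≤ Q.toReal := ENNReal.toReal_mono hQt hrQ
  refine ⟨h1.1, ?_⟩
  have h2 := h1.2
  have h3 := lintegral_rpow_enorm_lt_top_of_eLpNorm_lt_top hQ0 hQt hQ.2
  rw [eLpNorm_one_eq_lintegral_enorm] at h2
  refine (eLpNorm_lt_top_iff_lintegral_rpow_enorm_lt_top hr0 hrt).2
    (lt_of_le_of_lt ?_ (ENNReal.add_lt_top.2 ⟨h2, h3⟩))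
  rw [← lintegral_add_left' h1.1.enorm]
  refine lintegral_mono fun x => ?_
  rcases le_total ‖V x‖ₑ 1 with hx | hx
  · refine le_add_right ?_
    simpa using ENNReal.rpow_le_rpow_of_exponent_ge hx hr1
  · exact le_add_left (ENNReal.rpow_le_rpow_of_exponent_le hx hrQ')

/-- Young's inequality above with `X = f^{1/α}` and `Y = g^{1/β}`. -/
theorem mixedNorm_conv_le {p q : ℝ≥0∞} (hpq : p.HolderConjugate q) (hq : q ≠ ∞) {α β : ℝ}
    (hα0 : 0 < α) (hβ0 : 0 < β) (hαβ : α + β = 1) (hα : p⁻¹.toReal ≤ α) (hβ : p⁻¹.toReal ≤ β)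
    {f g : E3 → ℝ≥0∞} (hf : Measurable f) (hg : Measurable g) :
    mixedNorm p q (fun x y => f y * g (x - y)) ≤
      eLpNorm f (ENNReal.ofReal α⁻¹) volume * eLpNorm g (ENNReal.ofReal β⁻¹) volume := by
  have key : ∀ {γ : ℝ} (hγ : 0 < γ) (f : E3 → ℝ≥0∞),
      eLpNorm f (ENNReal.ofReal γ⁻¹) volume = (∫⁻ x, f x ^ γ⁻¹) ^ γ := by
    intro γ hγ f
    rw [eLpNorm_eq_lintegral_rpow_enorm_toReal (by simpa using hγ) ENNReal.ofReal_ne_top,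
      ENNReal.toReal_ofReal (by positivity)]
    simp
  have h := mixedNorm_young_le hpq hq hαβ hα hβ (hf.pow_const α⁻¹) (hg.pow_const β⁻¹)
  rw [key hα0, key hβ0]
  refine le_trans (le_of_eq ?_) h
  simp only [← ENNReal.rpow_mul, inv_mul_cancel₀ hα0.ne', inv_mul_cancel₀ hβ0.ne',
    ENNReal.rpow_one]

/-- The singular part `1 / |z|` on the ball of radius `δ`. -/
noncomputable def nearKernel (δ : ℝ) : E3 → ℝ≥0∞ :=
  (Metric.ball 0 δ).indicator fun z => ‖z‖ₑ⁻¹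

/-- The decaying function `1 / (1 + |z|)`. -/
noncomputable def decayKernel (z : E3) : ℝ≥0∞ := ENNReal.ofReal (1 + ‖z‖)⁻¹

theorem measurable_nearKernel (δ : ℝ) : Measurable (nearKernel δ) :=
  measurable_enorm.inv.indicator Metric.isOpen_ball.measurableSet

theorem measurable_decayKernel : Measurable decayKernel := by
  unfold decayKernel
  fun_prop

theorem eLpNorm_decayKernel_lt_top {a : ℝ≥0∞} (ha : 3 < a) :
    eLpNorm decayKernel a volume < ∞ := by
  by_cases hat : a = ∞
  · rw [hat, eLpNorm_exponent_top]
    refine lt_of_le_of_lt (essSup_le_of_ae_le 1 (Filter.Eventually.of_forall fun z => ?_))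
      ENNReal.one_lt_top
    simp only [decayKernel, enorm_eq_self]
    rw [ENNReal.ofReal_le_one]
    exact inv_le_one_of_one_le₀ (by simp)
  · have ha0 : a ≠ 0 := (lt_of_le_of_lt zero_le ha).ne'
    refine (eLpNorm_lt_top_iff_lintegral_rpow_enorm_lt_top ha0 hat).2 ?_
    have ha3 : (Module.finrank ℝ E3 : ℝ) < a.toReal := by
      have := (ENNReal.toReal_lt_toReal (by simp) hat).2 ha
      simpa using this
    refine lt_of_le_of_lt (le_of_eq (lintegral_congr fun z => ?_))
      (finite_integral_one_add_norm (μ := (volume : Measure E3)) ha3)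
    have hz : 0 < 1 + ‖z‖ := by positivity
    simp only [decayKernel, enorm_eq_self]
    rw [ENNReal.ofReal_rpow_of_pos (by positivity), Real.inv_rpow hz.le, Real.rpow_neg hz.le]

/-- In polar coordinates the integral becomes that of `y^{2-b}` on `(0,1)`, finite for `2 - b > -1`.
-/
theorem eLpNorm_nearKernel_lt_top {b : ℝ} (hb0 : 0 < b) (hb : b < 3) :
    eLpNorm (nearKernel 1) (ENNReal.ofReal b) volume < ∞ := by
  refine (eLpNorm_lt_top_iff_lintegral_rpow_enorm_lt_top (by simpa using hb0)
    ENNReal.ofReal_ne_top).2 ?_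
  have h := (integrableOn_fun_norm_addHaar (volume : Measure E3) (f := fun y : ℝ => y ^ (-b))
    (r := 1)).2 (by
      have h1 : IntegrableOn (fun y : ℝ => y ^ (2 - b)) (Set.Ioo 0 1) :=
        (intervalIntegral.integrableOn_Ioo_rpow_iff one_pos).2 (by linarith)
      refine h1.congr_fun (fun y hy => ?_) measurableSet_Ioo
      have hy0 : 0 < y := hy.1
      simp only [finrank_euclideanSpace, Fintype.card_fin, smul_eq_mul]
      rw [sub_eq_add_neg, Real.rpow_add hy0]
      norm_num)
  have h2 := h.2
  rw [hasFiniteIntegral_iff_enorm, ← lintegral_indicator Metric.isOpen_ball.measurableSet] at h2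
  refine lt_of_le_of_lt (lintegral_mono_ae ?_) h2
  filter_upwards [Measure.ae_ne volume (0 : E3)] with z hz0
  rw [ENNReal.toReal_ofReal hb0.le]
  by_cases hz : z ∈ Metric.ball (0 : E3) 1
  · have hz' : 0 < ‖z‖ := norm_pos_iff.2 hz0
    simp only [nearKernel, Set.indicator_of_mem hz, enorm_eq_self]
    rw [← ofReal_norm, ← ENNReal.ofReal_inv_of_pos hz', ENNReal.ofReal_rpow_of_pos (by positivity), Real.enorm_of_nonneg (by positivity),
      Real.inv_rpow hz'.le, Real.rpow_neg hz'.le]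
  · simp [nearKernel, Set.indicator_of_notMem hz, hb0]

theorem exists_eLpNorm_nearKernel_le {b : ℝ} (hb0 : 0 < b) (hb : b < 3) {ζ : ℝ≥0∞} (hζ : 0 < ζ) :
    ∃ δ : ℝ, 0 < δ ∧ eLpNorm (nearKernel δ) (ENNReal.ofReal b) volume ≤ ζ := by
  have h := tendsto_eLpNorm_indicator_zero (by simpa using hb0) ENNReal.ofReal_ne_top
    (eLpNorm_nearKernel_lt_top hb0 hb) (S := fun n => Metric.ball (0 : E3) (1 / ((n : ℝ) + 1)))
    (fun n => Metric.isOpen_ball.measurableSet)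
    (fun m n hmn => Metric.ball_subset_ball (one_div_le_one_div_of_le (by positivity)
      (by exact_mod_cast Nat.succ_le_succ hmn))) (by
      refine measure_mono_null (t := {0}) (fun z hz => ?_) (measure_singleton _)
      rw [Set.mem_iInter] at hz
      by_contra hz0
      obtain ⟨n, hn⟩ := exists_nat_one_div_lt (norm_pos_iff.2 hz0)
      have := hz n
      rw [mem_ball_zero_iff] at this
      linarith)
  obtain ⟨n, hn⟩ := ((ENNReal.tendsto_nhds_zero.1 h) ζ hζ).exists
  refine ⟨1 / ((n : ℝ) + 1), by positivity, le_trans (le_of_eq ?_) hn⟩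
  congr 1
  rw [nearKernel, nearKernel, Set.indicator_indicator, Set.inter_eq_left.2]
  refine Metric.ball_subset_ball ?_
  rw [div_le_one (by positivity)]
  simp

/-! ### Pointwise bounds for the resolvent kernel and its weighted form. -/

theorem norm_exp_I_mul_real (s : ℤˣ) (l r : ℝ) :
    ‖Complex.exp (Complex.I * (((s : ℤ) : ℂ) * l) * r)‖ = 1 := by
  rw [Complex.norm_exp]
  simp

theorem enorm_freeResolventKernel_le (s : ℤˣ) (l : ℝ) (x y : E3) :
    ‖freeResolventKernel s l x y‖ₑ ≤ ‖x - y‖ₑ⁻¹ := by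
  by_cases hz : x - y = 0
  · simp [hz]
  have hz' : 0 < ‖x - y‖ := norm_pos_iff.2 hz
  rw [← ofReal_norm, ← ofReal_norm, ← ENNReal.ofReal_inv_of_pos hz']
  refine ENNReal.ofReal_le_ofReal ?_
  rw [freeResolventKernel, helmholtzKernel, norm_div, norm_exp_I_mul_real, inv_eq_one_div]
  have hπ := Real.pi_gt_three
  have h : ‖(4 * Real.pi * ‖x - y‖ : ℂ)‖ = 4 * Real.pi * ‖x - y‖ := by
    simp [abs_of_pos Real.pi_pos]
  rw [h]
  refine one_div_le_one_div_of_le hz' ?_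
  nlinarith

theorem measurable_freeResolventKernel (s : ℤˣ) (l : ℝ) :
    Measurable (Function.uncurry (freeResolventKernel s l)) := by
  have hn : Measurable fun z : E3 × E3 => ((‖z.1 - z.2‖ : ℝ) : ℂ) := by fun_prop
  exact (Complex.measurable_exp.comp (hn.const_mul _)).div (hn.const_mul _)

theorem freeResolventKernel_comm (s : ℤˣ) (l : ℝ) (x y : E3) :
    freeResolventKernel s l x y = freeResolventKernel s l y x := by
  rw [freeResolventKernel, freeResolventKernel, helmholtzKernel, helmholtzKernel, norm_sub_rev]

/-- The kernel of the free resolvent with its singularity truncated at distance `δ`. -/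
noncomputable def truncatedResolventKernel (s : ℤˣ) (l δ : ℝ) (x y : E3) : ℂ :=
  Complex.exp (Complex.I * (((s : ℤ) : ℂ) * l) * ‖x - y‖) /
    (4 * Real.pi * ((max ‖x - y‖ δ : ℝ) : ℂ))

theorem continuous_truncatedResolventKernel (s : ℤˣ) (l : ℝ) {δ : ℝ} (hδ : 0 < δ) :
    Continuous (Function.uncurry (truncatedResolventKernel s l δ)) := by
  refine Continuous.div (f := fun z : E3 × E3 =>
    Complex.exp (Complex.I * (((s : ℤ) : ℂ) * l) * ‖z.1 - z.2‖))
    (g := fun z : E3 × E3 => (4 * Real.pi * ((max ‖z.1 - z.2‖ δ : ℝ) : ℂ)))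
    (by fun_prop) (by fun_prop) fun z => ?_
  have h : 0 < max ‖z.1 - z.2‖ δ := lt_max_of_lt_right hδ
  have hπ := Real.pi_pos
  exact_mod_cast (by positivity : (4 * Real.pi * max ‖z.1 - z.2‖ δ) ≠ 0)

/-- The truncation changes only the denominator, and only for `|x-y| < δ`. The common phase factors
out, leaving a difference between `0` and `1/|x-y|`. -/
theorem enorm_freeResolventKernel_sub_le (s : ℤˣ) (l : ℝ) {δ : ℝ} (hδ : 0 < δ) (x y : E3) :
    ‖freeResolventKernel s l x y - truncatedResolventKernel s l δ x y‖ₑ ≤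
      nearKernel δ (x - y) := by
  rcases le_or_gt δ ‖x - y‖ with h | h
  · simp [freeResolventKernel, helmholtzKernel, truncatedResolventKernel, max_eq_left h]
  have hmem : x - y ∈ Metric.ball (0 : E3) δ := by simpa using h
  rw [nearKernel, Set.indicator_of_mem hmem]
  by_cases hz : x - y = 0
  · simp [hz]
  have hz' : 0 < ‖x - y‖ := norm_pos_iff.2 hz
  have hπ := Real.pi_gt_three
  rw [← ofReal_norm, ← ofReal_norm, ← ENNReal.ofReal_inv_of_pos hz']
  refine ENNReal.ofReal_le_ofReal ?_
  rw [freeResolventKernel, helmholtzKernel, truncatedResolventKernel, max_eq_right h.le,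
    div_eq_mul_inv, div_eq_mul_inv, ← mul_sub, norm_mul, norm_exp_I_mul_real, one_mul]
  have h1 : ((4 * Real.pi * (‖x - y‖ : ℝ) : ℂ)⁻¹ - (4 * Real.pi * (δ : ℝ) : ℂ)⁻¹) =
      (((4 * Real.pi * ‖x - y‖)⁻¹ - (4 * Real.pi * δ)⁻¹ : ℝ) : ℂ) := by push_cast; rfl
  rw [h1, Complex.norm_real, Real.norm_eq_abs, abs_of_nonneg]
  · have h2 : (4 * Real.pi * ‖x - y‖)⁻¹ ≤ ‖x - y‖⁻¹ := inv_anti₀ hz' (by nlinarith)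
    have h3 : 0 ≤ (4 * Real.pi * δ)⁻¹ := by positivity
    linarith
  · rw [sub_nonneg]
    exact inv_anti₀ (by positivity) (by gcongr)

theorem enorm_weight_neg_one (x : E3) : ‖weight (-1) x‖ₑ = decayKernel x := by
  have h : 0 < 1 + ‖x‖ := by positivity
  rw [weight, decayKernel, ← ofReal_norm, Complex.norm_real, Real.rpow_neg_one,
    Real.norm_of_nonneg (by positivity)]

theorem enorm_weight_one (x : E3) : ‖weight 1 x‖ₑ = ENNReal.ofReal (1 + ‖x‖) := by
  have h : 0 < 1 + ‖x‖ := by positivity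
  rw [weight, ← ofReal_norm, Complex.norm_real, Real.rpow_one, Real.norm_of_nonneg h.le]

theorem memLp_weight_neg_one {p : ℝ≥0∞} (hp : 3 < p) : MemLp (weight (-1)) p volume := by
  refine ⟨(weight_continuous _).aestronglyMeasurable, ?_⟩
  rw [← eLpNorm_enorm]
  simp only [enorm_weight_neg_one]
  exact eLpNorm_decayKernel_lt_top hp

/-- The kernel of `R₀^±(λ²) V`, conjugated by the weight so as to act on unweighted spaces. -/
noncomputable def weightedResolventKernel (s : ℤˣ) (l : ℝ) (V : E3 → ℂ) (x y : E3) : ℂ :=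
  weight (-1) x * freeResolventKernel s l x y * (V y * weight 1 y)

theorem decayKernel_mul_le (x y : E3) :
    decayKernel x * ENNReal.ofReal (1 + ‖y‖) * ‖x - y‖ₑ⁻¹ ≤
      nearKernel 1 (x - y) + 2 * decayKernel (x - y) + decayKernel x := by
  by_cases hz : x - y = 0
  -- On the diagonal the inverse in `ℝ≥0∞` takes the value `∞`, so the right side is infinite.
  · have : nearKernel 1 (x - y) = ∞ := by simp [nearKernel, hz]
    simp [this]
  have hz' : 0 < ‖x - y‖ := norm_pos_iff.2 hz
  have hx : 0 < 1 + ‖x‖ := by positivity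
  have htri : ‖y‖ ≤ ‖x‖ + ‖x - y‖ := by
    have := norm_le_norm_add_norm_sub x y
    simpa [norm_sub_rev] using this
  have h1 : decayKernel x * ENNReal.ofReal (1 + ‖y‖) * ‖x - y‖ₑ⁻¹ ≤
      ‖x - y‖ₑ⁻¹ + decayKernel x := by
    rw [← ofReal_norm, ← ENNReal.ofReal_inv_of_pos hz', decayKernel,
      ← ENNReal.ofReal_mul (by positivity), ← ENNReal.ofReal_mul (by positivity),
      ← ENNReal.ofReal_add (by positivity) (by positivity)]
    refine ENNReal.ofReal_le_ofReal ?_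
    have : ‖x - y‖⁻¹ + (1 + ‖x‖)⁻¹ = (1 + ‖x‖)⁻¹ * (1 + ‖x‖ + ‖x - y‖) * ‖x - y‖⁻¹ := by
      field_simp
    rw [this]
    exact mul_le_mul_of_nonneg_right (mul_le_mul_of_nonneg_left (by linarith) (by positivity))
      (by positivity)
  refine h1.trans (add_le_add ?_ le_rfl)
  by_cases hm : x - y ∈ Metric.ball (0 : E3) 1
  · rw [nearKernel, Set.indicator_of_mem hm]
    exact le_self_add
  · refine le_add_left ?_
    have h2 : 1 ≤ ‖x - y‖ := by simpa using hm
    have h3 : (2 : ℝ≥0∞) * decayKernel (x - y) = ENNReal.ofReal (2 * (1 + ‖x - y‖)⁻¹) := by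
      rw [ENNReal.ofReal_mul (by norm_num), decayKernel, ENNReal.ofReal_ofNat]
    rw [h3, ← ofReal_norm, ← ENNReal.ofReal_inv_of_pos hz']
    refine ENNReal.ofReal_le_ofReal ?_
    rw [← div_eq_mul_inv, inv_eq_one_div, div_le_div_iff₀ hz' (by positivity)]
    linarith

theorem enorm_weightedResolventKernel_le (s : ℤˣ) (l : ℝ) (V : E3 → ℂ) (x y : E3) :
    ‖weightedResolventKernel s l V x y‖ₑ ≤
      (‖V y‖ₑ * nearKernel 1 (x - y) + 2 * (‖V y‖ₑ * decayKernel (x - y))) +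
        decayKernel x * ‖V y‖ₑ := by
  rw [weightedResolventKernel, enorm_mul, enorm_mul, enorm_mul, enorm_weight_neg_one,
    enorm_weight_one]
  calc decayKernel x * ‖freeResolventKernel s l x y‖ₑ * (‖V y‖ₑ * ENNReal.ofReal (1 + ‖y‖))
      ≤ decayKernel x * ‖x - y‖ₑ⁻¹ * (‖V y‖ₑ * ENNReal.ofReal (1 + ‖y‖)) := by
        gcongr
        exact enorm_freeResolventKernel_le s l x y
    _ = ‖V y‖ₑ * (decayKernel x * ENNReal.ofReal (1 + ‖y‖) * ‖x - y‖ₑ⁻¹) := by ring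
    _ ≤ ‖V y‖ₑ * (nearKernel 1 (x - y) + 2 * decayKernel (x - y) + decayKernel x) := by
        gcongr
        exact decayKernel_mul_le x y
    _ = _ := by ring

theorem measurable_weightedResolventKernel (s : ℤˣ) (l : ℝ) {V : E3 → ℂ} (hV : Measurable V) :
    Measurable (Function.uncurry (weightedResolventKernel s l V)) :=
  (((weight_continuous _).measurable.comp measurable_fst).mul
    (measurable_freeResolventKernel s l)).mul
    ((hV.mul (weight_continuous _).measurable).comp measurable_snd)

/-! ### Compactness of the weighted resolvent kernel. -/

theorem inv_lt_three {β : ℝ} (h : 1 / 3 < β) : β⁻¹ < 3 := by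
  rw [inv_lt_comm₀ (by linarith) (by norm_num)]
  linarith

theorem three_lt_ofReal_inv {β : ℝ} (h0 : 0 < β) (h : β < 1 / 3) : 3 < ENNReal.ofReal β⁻¹ := by
  rw [show (3 : ℝ≥0∞) = ENNReal.ofReal 3 by simp, ENNReal.ofReal_lt_ofReal_iff (by positivity),
    lt_inv_comm₀ (by norm_num) h0]
  linarith

/-- Young with `(α, 1-α)` treats the singular part, where `1/(1-α) < 3`; Young with `(α', 1-α')`
treats the tail, where `1/(1-α') > 3`. Since `C` does not depend on `V`, small norms of a potential
give a small mixed norm, which is what permits cutting `V` off. -/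
theorem exists_mixedNorm_weightedResolventKernel_le {p q : ℝ≥0∞} (hpq : p.HolderConjugate q)
    (hq : q ≠ ∞) (hp3 : 3 < p) (s : ℤˣ) (l : ℝ) {α α' : ℝ} (hα : p⁻¹.toReal ≤ α) (hα0 : 0 < α)
    (hα1 : α < 2 / 3) (hβ : p⁻¹.toReal ≤ 1 - α) (hα' : p⁻¹.toReal ≤ α') (hα'0 : 2 / 3 < α')
    (hα'1 : α' < 1) (hβ' : p⁻¹.toReal ≤ 1 - α') :
    ∃ C : ℝ≥0∞, C ≠ ∞ ∧ ∀ V : E3 → ℂ, Measurable V →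
      mixedNorm p q (fun x y => ‖weightedResolventKernel s l V x y‖ₑ) ≤
        C * (eLpNorm V (ENNReal.ofReal α⁻¹) volume + eLpNorm V (ENNReal.ofReal α'⁻¹) volume +
          eLpNorm V q volume) := by
  set c₁ := eLpNorm (nearKernel 1) (ENNReal.ofReal (1 - α)⁻¹) volume with hc₁
  set c₂ := eLpNorm decayKernel (ENNReal.ofReal (1 - α')⁻¹) volume with hc₂
  set c₃ := eLpNorm decayKernel p volume with hc₃
  have h₁ : c₁ ≠ ∞ := (eLpNorm_nearKernel_lt_top (inv_pos.2 (by linarith))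
    (inv_lt_three (by linarith))).ne
  have h₂ : c₂ ≠ ∞ :=
    (eLpNorm_decayKernel_lt_top (three_lt_ofReal_inv (by linarith) (by linarith))).ne
  have h₃ : c₃ ≠ ∞ := (eLpNorm_decayKernel_lt_top hp3).ne
  refine ⟨c₁ + 2 * c₂ + c₃, by simp [h₁, h₂, h₃, ENNReal.mul_eq_top], fun V hV => ?_⟩
  have m₁ : Measurable (Function.uncurry fun x y : E3 => ‖V y‖ₑ * nearKernel 1 (x - y)) :=
    (hV.enorm.comp measurable_snd).mul
      ((measurable_nearKernel 1).comp (measurable_fst.sub measurable_snd))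
  have m₂ : Measurable (Function.uncurry fun x y : E3 => ‖V y‖ₑ * decayKernel (x - y)) :=
    (hV.enorm.comp measurable_snd).mul
      (measurable_decayKernel.comp (measurable_fst.sub measurable_snd))
  have m₃ : Measurable (Function.uncurry fun x y : E3 => decayKernel x * ‖V y‖ₑ) :=
    (measurable_decayKernel.comp measurable_fst).mul (hV.enorm.comp measurable_snd)
  have m₂' : Measurable (Function.uncurry fun x y : E3 => 2 * (‖V y‖ₑ * decayKernel (x - y))) :=
    m₂.const_mul 2
  have b₁ := mixedNorm_conv_le hpq hq hα0 (by linarith) (add_sub_cancel α 1) hα hβ hV.enorm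
    (measurable_nearKernel 1)
  have b₂ := mixedNorm_conv_le hpq hq (by linarith) (by linarith) (add_sub_cancel α' 1) hα' hβ'
    hV.enorm measurable_decayKernel
  have b₃ := mixedNorm_mul_le (p := p) (q := q) measurable_decayKernel hV.enorm
  rw [eLpNorm_enorm] at b₁ b₂ b₃
  rw [← hc₁] at b₁
  rw [← hc₂] at b₂
  rw [← hc₃] at b₃
  set e₁ := eLpNorm V (ENNReal.ofReal α⁻¹) volume
  set e₂ := eLpNorm V (ENNReal.ofReal α'⁻¹) volume
  set e₃ := eLpNorm V q volume
  calc mixedNorm p q (fun x y => ‖weightedResolventKernel s l V x y‖ₑ)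
      ≤ _ := mixedNorm_mono (enorm_weightedResolventKernel_le s l V)
    _ ≤ _ := mixedNorm_add_le hpq.one_le hpq.symm.one_le hq (m₁.add m₂') m₃
    _ ≤ _ := add_le_add_left (mixedNorm_add_le hpq.one_le hpq.symm.one_le hq m₁ m₂') _
    _ ≤ (e₁ * c₁ + 2 * (e₂ * c₂)) + c₃ * e₃ := by
      refine add_le_add (add_le_add b₁ ?_) b₃
      exact (mixedNorm_const_mul_le hpq.symm.ne_zero hq 2 m₂).trans (mul_le_mul_right b₂ 2)
    _ ≤ (c₁ + 2 * c₂ + c₃) * (e₁ + e₂ + e₃) := by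
      have l₁ : c₁ ≤ c₁ + 2 * c₂ + c₃ := by rw [add_assoc]; exact le_self_add
      have l₂ : 2 * c₂ ≤ c₁ + 2 * c₂ + c₃ := by
        rw [add_right_comm]; exact le_add_self
      have l₃ : c₃ ≤ c₁ + 2 * c₂ + c₃ := le_add_self
      calc (e₁ * c₁ + 2 * (e₂ * c₂)) + c₃ * e₃ = c₁ * e₁ + (2 * c₂) * e₂ + c₃ * e₃ := by ring
        _ ≤ _ := add_le_add (add_le_add (mul_le_mul_left l₁ _) (mul_le_mul_left l₂ _))
          (mul_le_mul_left l₃ _)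
        _ = _ := by ring

theorem tendsto_eLpNorm_indicator_compl_closedBall {V : E3 → ℂ} {a : ℝ≥0∞} (ha0 : a ≠ 0)
    (ha : a ≠ ∞) (hV : MemLp V a volume) :
    Filter.Tendsto (fun n : ℕ => eLpNorm ((Metric.closedBall (0 : E3) n)ᶜ.indicator V) a volume)
      Filter.atTop (nhds 0) := by
  have h := tendsto_eLpNorm_indicator_zero ha0 ha (f := fun x => ‖V x‖ₑ)
    (by rw [eLpNorm_enorm]; exact hV.2) (S := fun n : ℕ => (Metric.closedBall (0 : E3) n)ᶜ)
    (fun n => Metric.isClosed_closedBall.measurableSet.compl)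
    (fun m n hmn => Set.compl_subset_compl.2
      (Metric.closedBall_subset_closedBall (by exact_mod_cast hmn))) (by
      convert measure_empty (μ := (volume : Measure E3))
      rw [Set.eq_empty_iff_forall_notMem]
      intro x hx
      obtain ⟨n, hn⟩ := exists_nat_ge ‖x‖
      exact (Set.mem_iInter.1 hx n) (by simpa using hn))
  refine h.congr fun n => ?_
  rw [← eLpNorm_enorm ((Metric.closedBall (0 : E3) n)ᶜ.indicator V)]
  congr 1
  ext x
  rw [enorm_indicator_eq_indicator_enorm]

section

variable {p q : ℝ≥0∞} [Fact (1 ≤ p)] [Fact (1 ≤ q)]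

/-- Truncating the singularity at distance `δ` costs at most `|b(y)|` times `nearKernel δ` of `x -
y`. By Young this tends to `0` with `δ`, and the truncated kernel is continuous. -/
theorem isCompactPair_freeResolventKernel_of_support (hpq : p.HolderConjugate q) (hq : q ≠ ∞)
    (s : ℤˣ) (l : ℝ) {α : ℝ} (hα : p⁻¹.toReal ≤ α) (hα0 : 0 < α) (hα' : α < 2 / 3)
    (hβ : p⁻¹.toReal ≤ 1 - α) {a b : E3 → ℂ} (ha : Measurable a) (hap : MemLp a p volume)
    (ha1 : ∀ x, ‖a x‖ₑ ≤ 1) (hb : Measurable b) (hbq : MemLp b q volume)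
    (hbα : MemLp b (ENNReal.ofReal α⁻¹) volume)
    {R : ℝ} (haR : ∀ x, R < ‖x‖ → a x = 0) (hbR : ∀ x, R < ‖x‖ → b x = 0) :
    IsCompactPair p q fun x y => a x * freeResolventKernel s l x y * b y := by
  refine .of_approx hpq hq (((ha.comp measurable_fst).mul
    (measurable_freeResolventKernel s l)).mul (hb.comp measurable_snd)) fun η hη => ?_
  obtain ⟨ε, hε, hεη⟩ := ENNReal.exists_nnreal_pos_mul_lt hbα.eLpNorm_ne_top hη.ne'
  obtain ⟨δ, hδ, hδε⟩ := exists_eLpNorm_nearKernel_le (b := (1 - α)⁻¹)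
    (inv_pos.2 (by linarith)) (inv_lt_three (by linarith)) (ENNReal.coe_pos.2 hε)
  refine ⟨_, isCompactPair_of_continuous hpq hq (continuous_truncatedResolventKernel s l hδ)
    ha hap hb hbq haR hbR, ?_⟩
  have hpt : ∀ x y, ‖a x * freeResolventKernel s l x y * b y -
      a x * truncatedResolventKernel s l δ x y * b y‖ₑ ≤ ‖b y‖ₑ * nearKernel δ (x - y) := by
    intro x y
    rw [← sub_mul, ← mul_sub, enorm_mul, enorm_mul, mul_comm]
    gcongr
    calc _ ≤ 1 * nearKernel δ (x - y) :=
          mul_le_mul' (ha1 x) (enorm_freeResolventKernel_sub_le s l hδ x y)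
      _ = _ := one_mul _
  refine (mixedNorm_mono hpt).trans ((mixedNorm_conv_le hpq hq hα0 (by linarith)
    (add_sub_cancel _ _) hα hβ hb.enorm (measurable_nearKernel δ)).trans ?_)
  rw [eLpNorm_enorm, mul_comm]
  exact (mul_le_mul_left hδε _).trans hεη.le

theorem isCompactPair_weight_mul_freeResolventKernel (hpq : p.HolderConjugate q) (hq : q ≠ ∞)
    (hp3 : 3 < p) (s : ℤˣ) (l : ℝ) {α : ℝ} (hα : p⁻¹.toReal ≤ α) (hα0 : 0 < α) (hα' : α < 2 / 3)
    (hβ : p⁻¹.toReal ≤ 1 - α) {b : E3 → ℂ} (hb : Measurable b) (hbq : MemLp b q volume)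
    (hbα : MemLp b (ENNReal.ofReal α⁻¹) volume)
    {M : ℝ} (hbM : ∀ x, M < ‖x‖ → b x = 0) :
    IsCompactPair p q fun x y => weight (-1) x * freeResolventKernel s l x y * b y := by
  have hw := (weight_continuous (-1)).measurable
  refine .of_approx hpq hq (((hw.comp measurable_fst).mul
    (measurable_freeResolventKernel s l)).mul (hb.comp measurable_snd)) fun η hη => ?_
  obtain ⟨ε, hε, hεη⟩ := ENNReal.exists_nnreal_pos_mul_lt
    (ENNReal.mul_ne_top (eLpNorm_decayKernel_lt_top hp3).ne hbq.eLpNorm_ne_top) hη.ne'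
  have hε' : (0 : ℝ) < ε := hε
  -- For `|x| > R` and `|y| ≤ M` one has `|x-y| ≥ 1/ε`, so the resolvent kernel is at most `ε` on
  -- the discarded region.
  set R : ℝ := M + (ε : ℝ)⁻¹ with hR
  have hMR : M ≤ R := by
    rw [hR]
    have : 0 < (ε : ℝ)⁻¹ := by positivity
    linarith
  have hball : MeasurableSet (Metric.closedBall (0 : E3) R) := Metric.isClosed_closedBall.measurableSet
  refine ⟨fun x y => (Metric.closedBall (0 : E3) R).indicator (weight (-1)) x *
    freeResolventKernel s l x y * b y, isCompactPair_freeResolventKernel_of_support hpq hq s l hα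
    hα0 hα' hβ (hw.indicator hball) ((memLp_weight_neg_one hp3).indicator hball) (fun x => ?_) hb
    hbq hbα (R := R) (fun x hx => ?_) (fun x hx => hbM x (hMR.trans_lt hx)), ?_⟩
  · refine (enorm_indicator_le_enorm_self _ _).trans ?_
    rw [enorm_weight_neg_one, decayKernel, ENNReal.ofReal_le_one]
    exact inv_le_one_of_one_le₀ (by simp)
  · exact Set.indicator_of_notMem (by simpa using hx) _
  have hpt : ∀ x y, ‖weight (-1) x * freeResolventKernel s l x y * b y -
      (Metric.closedBall (0 : E3) R).indicator (weight (-1)) x *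
        freeResolventKernel s l x y * b y‖ₑ ≤ ε * (decayKernel x * ‖b y‖ₑ) := by
    intro x y
    by_cases hx : ‖x‖ ≤ R
    · rw [Set.indicator_of_mem (by simpa using hx)]
      simp
    rw [Set.indicator_of_notMem (by simpa using hx)]
    by_cases hy : ‖y‖ ≤ M
    swap
    · simp [hbM y (not_le.1 hy)]
    have hxy : (ε : ℝ)⁻¹ ≤ ‖x - y‖ := by
      have := norm_sub_norm_le x y
      rw [hR] at hx
      linarith
    have hxy' : 0 < ‖x - y‖ := lt_of_lt_of_le (by positivity) hxy
    have hK : ‖freeResolventKernel s l x y‖ₑ ≤ ε := by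
      refine (enorm_freeResolventKernel_le s l x y).trans ?_
      rw [← ofReal_norm, ← ENNReal.ofReal_inv_of_pos hxy', ← ENNReal.ofReal_coe_nnreal]
      exact ENNReal.ofReal_le_ofReal (inv_le_of_inv_le₀ hε' hxy)
    rw [zero_mul, zero_mul, sub_zero, enorm_mul, enorm_mul, enorm_weight_neg_one]
    calc decayKernel x * ‖freeResolventKernel s l x y‖ₑ * ‖b y‖ₑ
        ≤ decayKernel x * ε * ‖b y‖ₑ := by gcongr
      _ = _ := by ring
  have hm : Measurable (Function.uncurry fun x y : E3 => decayKernel x * ‖b y‖ₑ) :=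
    (measurable_decayKernel.comp measurable_fst).mul (hb.enorm.comp measurable_snd)
  refine (mixedNorm_mono hpt).trans ((mixedNorm_const_mul_le hpq.symm.ne_zero hq _ hm).trans
    (le_trans ?_ hεη.le))
  refine mul_le_mul_right ((mixedNorm_mul_le measurable_decayKernel hb.enorm).trans ?_) _
  rw [eLpNorm_enorm]

theorem isCompactPair_weightedResolventKernel (hpq : p.HolderConjugate q) (hq : q ≠ ∞)
    (hp3 : 3 < p) (s : ℤˣ) (l : ℝ) {α α' : ℝ} (hα : p⁻¹.toReal ≤ α) (hα0 : 0 < α)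
    (hα1 : α < 2 / 3) (hβ : p⁻¹.toReal ≤ 1 - α) (hα' : p⁻¹.toReal ≤ α') (hα'0 : 2 / 3 < α')
    (hα'1 : α' < 1) (hβ' : p⁻¹.toReal ≤ 1 - α') {V : E3 → ℂ} (hV : Measurable V)
    (hVα : MemLp V (ENNReal.ofReal α⁻¹) volume) (hVα' : MemLp V (ENNReal.ofReal α'⁻¹) volume)
    (hVq : MemLp V q volume) :
    IsCompactPair p q (weightedResolventKernel s l V) := by
  refine .of_approx hpq hq (measurable_weightedResolventKernel s l hV) fun η hη => ?_
  obtain ⟨C, hC, hbound⟩ := exists_mixedNorm_weightedResolventKernel_le hpq hq hp3 s l hα hα0 hα1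
    hβ hα' hα'0 hα'1 hβ'
  have hlim := ((tendsto_eLpNorm_indicator_compl_closedBall (by simpa using hα0)
    ENNReal.ofReal_ne_top hVα).add (tendsto_eLpNorm_indicator_compl_closedBall
    (by simpa using (by linarith : 0 < α')) ENNReal.ofReal_ne_top hVα')).add
    (tendsto_eLpNorm_indicator_compl_closedBall hpq.symm.ne_zero hq hVq)
  have hlim' := ENNReal.Tendsto.const_mul hlim (Or.inr hC)
  rw [add_zero, add_zero, mul_zero] at hlim'
  obtain ⟨n, hn⟩ := (ENNReal.tendsto_nhds_zero.1 hlim' η hη).exists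
  have hball : MeasurableSet (Metric.closedBall (0 : E3) n) :=
    Metric.isClosed_closedBall.measurableSet
  set W := (Metric.closedBall (0 : E3) n).indicator V with hW
  have hWm : Measurable W := hV.indicator hball
  have hWsupp : ∀ x, (n : ℝ) < ‖x‖ → W x = 0 := fun x hx =>
    Set.indicator_of_notMem (by simpa using hx) _
  -- On the support of the cut-off potential the growing weight `1+|y|` is bounded by `1 + n`.
  have hWr : ∀ {r : ℝ≥0∞}, MemLp V r volume → MemLp (fun y => W y * weight 1 y) r volume := by
    intro r hr
    refine (hr.indicator hball).of_le_mul (c := 1 + n)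
      (hWm.mul (weight_continuous _).measurable).aestronglyMeasurable
      (Filter.Eventually.of_forall fun y => ?_)
    rw [norm_mul, mul_comm]
    by_cases hy : ‖y‖ ≤ n
    · refine mul_le_mul_of_nonneg_right ?_ (norm_nonneg _)
      rw [weight, Complex.norm_real, Real.rpow_one, Real.norm_of_nonneg (by positivity)]
      linarith
    · rw [hWsupp y (not_le.1 hy), norm_zero, mul_zero]
      positivity
  refine ⟨weightedResolventKernel s l W, isCompactPair_weight_mul_freeResolventKernel hpq hq hp3
    s l hα hα0 hα1 hβ (hWm.mul (weight_continuous _).measurable) (hWr hVq) (hWr hVα) (M := n)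
    (fun x hx => by simp [hWsupp x hx]), le_trans (le_of_eq ?_)
    ((hbound _ (hV.indicator hball.compl)).trans hn)⟩
  congr 1
  ext x y
  have hsplit : V y - W y = (Metric.closedBall (0 : E3) n)ᶜ.indicator V y := by
    have := congrFun (Set.indicator_self_add_compl (Metric.closedBall (0 : E3) n) V) y
    rw [← this, Pi.add_apply, hW, add_sub_cancel_left]
  rw [weightedResolventKernel, weightedResolventKernel, weightedResolventKernel, ← mul_sub,
    ← sub_mul, hsplit]

end

/-! ### Return to the weighted spaces, and the main theorem. -/

/-- Multiplication by the weight, as an isometric isomorphism from `L^{p,σ}` to `L^p`. -/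
noncomputable def WeightedLp.toLpEquiv (p : ℝ≥0∞) [Fact (1 ≤ p)] (σ : ℝ) :
    WeightedLp p σ ≃ₗᵢ[ℂ] Lp ℂ p (volume : Measure E3) where
  toLinearEquiv := LinearEquiv.ofBijective (WeightedLp.toLp p σ)
    ⟨WeightedLp.toLp_injective, WeightedLp.toLp_surjective⟩
  norm_map' _ := rfl

theorem WeightedLp.coeFn_toLpEquiv {p : ℝ≥0∞} [Fact (1 ≤ p)] {σ : ℝ} (f : WeightedLp p σ) :
    WeightedLp.toLpEquiv p σ f =ᵐ[volume] fun x => weight σ x * f x :=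
  (WeightedLp.memLp f).coeFn_toLp

/-- The operator on `L^{p,σ}` that corresponds to a given operator on `L^p`. -/
noncomputable def WeightedLp.conj {p : ℝ≥0∞} [Fact (1 ≤ p)] (σ : ℝ)
    (A : Lp ℂ p (volume : Measure E3) →L[ℂ] Lp ℂ p (volume : Measure E3)) :
    WeightedLp p σ →L[ℂ] WeightedLp p σ :=
  ((WeightedLp.toLpEquiv p σ).symm.toContinuousLinearEquiv :
      Lp ℂ p (volume : Measure E3) →L[ℂ] WeightedLp p σ) ∘L A ∘L
    ((WeightedLp.toLpEquiv p σ).toContinuousLinearEquiv :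
      WeightedLp p σ →L[ℂ] Lp ℂ p (volume : Measure E3))

section

variable {p : ℝ≥0∞} [Fact (1 ≤ p)] {σ : ℝ}
  {A : Lp ℂ p (volume : Measure E3) →L[ℂ] Lp ℂ p (volume : Measure E3)}

theorem WeightedLp.isCompactOperator_conj (hA : IsCompactOperator A) :
    IsCompactOperator (WeightedLp.conj σ A) :=
  (hA.comp_clm ((WeightedLp.toLpEquiv p σ).toContinuousLinearEquiv :
    WeightedLp p σ →L[ℂ] Lp ℂ p (volume : Measure E3))).clm_comp
    ((WeightedLp.toLpEquiv p σ).symm.toContinuousLinearEquiv :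
      Lp ℂ p (volume : Measure E3) →L[ℂ] WeightedLp p σ)

theorem WeightedLp.weight_mul_conj (f : WeightedLp p σ) :
    (fun x => weight σ x * WeightedLp.conj σ A f x) =ᵐ[volume] A (WeightedLp.toLpEquiv p σ f) := by
  refine (WeightedLp.coeFn_toLpEquiv (WeightedLp.conj σ A f)).symm.trans ?_
  have : WeightedLp.toLpEquiv p σ (WeightedLp.conj σ A f) = A (WeightedLp.toLpEquiv p σ f) :=
    (WeightedLp.toLpEquiv p σ).apply_symm_apply _
  rw [this]

end

theorem weight_neg_mul_weight (σ : ℝ) (x : E3) : weight (-σ) x * weight σ x = 1 := by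
  rw [mul_comm, weight_mul_weight_neg]

theorem memLp_weight_neg_four {r : ℝ≥0∞} (hr : 1 ≤ r) (hrt : r ≠ ∞) :
    MemLp (weight (-4)) r volume := by
  have hr0 : r ≠ 0 := (lt_of_lt_of_le zero_lt_one hr).ne'
  have hr1 : 1 ≤ r.toReal := by
    rw [← ENNReal.toReal_one]
    exact ENNReal.toReal_mono hrt hr
  refine ⟨(weight_continuous _).aestronglyMeasurable,
    (eLpNorm_lt_top_iff_lintegral_rpow_enorm_lt_top hr0 hrt).2 ?_⟩
  have h3 : (Module.finrank ℝ E3 : ℝ) < 4 * r.toReal := by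
    simp only [finrank_euclideanSpace, Fintype.card_fin]
    push_cast
    linarith
  refine lt_of_le_of_lt (le_of_eq (lintegral_congr fun z => ?_))
    (finite_integral_one_add_norm (μ := (volume : Measure E3)) h3)
  have hz : 0 < 1 + ‖z‖ := by positivity
  rw [weight, ← ofReal_norm, Complex.norm_real, Real.norm_of_nonneg (by positivity),
    ENNReal.ofReal_rpow_of_pos (by positivity), ← Real.rpow_mul hz.le, neg_mul]

theorem mainTheorem7 (ε : ℝ) (hε : 0 < ε) (V : E3 → ℝ)
    (hV : MemLp V (ENNReal.ofReal (3 / 2 * (1 + ε))) volume) (hV1 : MemLp V 1 volume)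
    (p p' : ℝ≥0∞) [Fact (1 ≤ p)] [Fact (1 ≤ p')] (hpp' : p.HolderConjugate p')
    (hp : ENNReal.ofReal ((1 + ε) / ε) ≤ p) (hp3 : 3 < p) (l : ℝ) (s : ℤˣ) :
    (∃ T : WeightedLp p (-1) →L[ℂ] WeightedLp p (-1), IsCompactOperator T ∧
      ∀ f : WeightedLp p (-1), IsFreeResolvent s l (fun y => (V y : ℂ) * f y) (T f)) ∧
    (∃ S : WeightedLp p' 1 →L[ℂ] WeightedLp p' 1, IsCompactOperator S ∧
      ∀ g : WeightedLp p' 1, ∃ u : E3 → ℂ, IsFreeResolvent (-s) l g u ∧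
        S g =ᵐ[volume] fun x => (V x : ℂ) * u x) := by
  have hp1 : p ≠ 1 := ((by norm_num : (1 : ℝ≥0∞) < 3).trans hp3).ne'
  have hq : p' ≠ ∞ := fun h => hp1 ((ENNReal.HolderConjugate.eq_top_iff_eq_one p' p).1 h)
  have hq0 : p' ≠ 0 := hpp'.symm.ne_zero
  set t : ℝ := p⁻¹.toReal with ht
  have ht0 : 0 ≤ t := ENNReal.toReal_nonneg
  have ht3 : t < 1 / 3 := by
    have h := (ENNReal.toReal_lt_toReal (ENNReal.inv_ne_top.2 hpp'.ne_zero)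
      (by simp : (3 : ℝ≥0∞)⁻¹ ≠ ∞)).2 (ENNReal.inv_lt_inv.2 hp3)
    rw [one_div]
    simpa [ht] using h
  have htq : t + p'.toReal⁻¹ = 1 := by
    have h := congrArg ENNReal.toReal hpp'.inv_add_inv_eq_one
    rwa [ENNReal.toReal_add (ENNReal.inv_ne_top.2 hpp'.ne_zero) (ENNReal.inv_ne_top.2 hq0),
      ENNReal.toReal_inv p', ENNReal.toReal_one] at h
  -- Capping `ε` at `1/2` keeps `4/9 ≤ α < 2/3`, so both `α` and `1 - α` exceed `1/3 > 1/p`, while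
  -- `1/α` stays at most `3/2 (1+ε)`.
  set m : ℝ := min ε (1 / 2) with hm
  have hm0 : 0 < m := lt_min hε (by norm_num)
  have hm1 : m ≤ 1 / 2 := min_le_right _ _
  have hmε : m ≤ ε := min_le_left _ _
  set α : ℝ := (3 / 2 * (1 + m))⁻¹ with hα
  have hα1 : α < 2 / 3 := by
    rw [hα, inv_lt_comm₀ (by positivity) (by norm_num)]
    linarith
  have hα4 : 4 / 9 ≤ α := by
    rw [hα, le_inv_comm₀ (by norm_num) (by positivity)]
    linarith
  -- Here `1 - α'` is the midpoint of `1/p` and `1/3`: large enough for Young, small enough for the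
  -- tail to be integrable.
  set α' : ℝ := 1 - (t + 1 / 3) / 2 with hα'
  have hα'1 : 2 / 3 < α' := by linarith
  obtain ⟨W₀, hW₀m, hVW₀⟩ := hV1.1.aemeasurable
  set W : E3 → ℂ := fun x => (W₀ x : ℂ) with hW
  have hWm : Measurable W := Complex.measurable_ofReal.comp hW₀m
  have hVW : ∀ᵐ x, (V x : ℂ) = W x := hVW₀.mono fun x hx => by rw [hx]
  have hWr : ∀ {r : ℝ≥0∞}, MemLp V r volume → MemLp W r volume := fun h =>
    MemLp.ofReal ((memLp_congr_ae hVW₀).1 h)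
  have hWI : ∀ {r : ℝ≥0∞}, 1 ≤ r → r ≤ ENNReal.ofReal (3 / 2 * (1 + ε)) → MemLp W r volume :=
    fun h1 h2 => memLp_of_one_of_exponent_le (hWr hV1) (hWr hV) ENNReal.ofReal_ne_top h1 h2
  have hαr : 1 ≤ ENNReal.ofReal α⁻¹ := by
    rw [ENNReal.one_le_ofReal]
    exact (one_le_inv₀ (by linarith)).2 (by linarith)
  have hα'r : 1 ≤ ENNReal.ofReal α'⁻¹ := by
    rw [ENNReal.one_le_ofReal]
    exact (one_le_inv₀ (by linarith)).2 (by linarith)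
  have key : ∀ (s : ℤˣ) (U : E3 → ℂ), Measurable U → MemLp U (ENNReal.ofReal α⁻¹) volume →
      MemLp U (ENNReal.ofReal α'⁻¹) volume → MemLp U p' volume →
      IsCompactPair p p' (weightedResolventKernel s l U) := fun s U hU h1 h2 h3 =>
    isCompactPair_weightedResolventKernel hpp' hq hp3 s l (by linarith) (by linarith) hα1
      (by linarith) (by linarith) hα'1 (by linarith) (by linarith) hU h1 h2 h3
  have keyW : ∀ s : ℤˣ, IsCompactPair p p' (weightedResolventKernel s l W) := fun s => by
    refine key s W hWm (hWI hαr (ENNReal.ofReal_le_ofReal ?_))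
      (hWI hα'r (ENNReal.ofReal_le_ofReal ?_)) (hWI hpp'.symm.one_le ?_)
    · rw [hα, inv_inv]
      gcongr
    · rw [inv_le_comm₀ (by linarith) (by positivity)]
      refine le_trans ?_ hα'1.le
      rw [inv_le_comm₀ (by positivity) (by norm_num)]
      linarith
    · rw [← ENNReal.ofReal_toReal hq]
      refine ENNReal.ofReal_le_ofReal ?_
      rw [← inv_inv p'.toReal, inv_le_comm₀ (by linarith) (by positivity)]
      refine le_trans ?_ (by linarith : 2 / 3 ≤ p'.toReal⁻¹)
      rw [inv_le_comm₀ (by positivity) (by norm_num)]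
      linarith
  constructor
  · obtain ⟨-, ⟨A, hA, hAc⟩, -⟩ := keyW s
    refine ⟨WeightedLp.conj (-1) A, WeightedLp.isCompactOperator_conj hAc, fun f => ?_⟩
    have hcoe : ∀ᵐ y, WeightedLp.toLpEquiv p (-1) f y = weight (-1) y * f y :=
      WeightedLp.coeFn_toLpEquiv f
    filter_upwards [hA (WeightedLp.toLpEquiv p (-1) f), WeightedLp.weight_mul_conj (A := A) f]
      with x hx hTx
    have hker : (fun y => weightedResolventKernel s l W x y * WeightedLp.toLpEquiv p (-1) f y)
        =ᵐ[volume] fun y => weight (-1) x * (freeResolventKernel s l x y * (V y * f y)) := by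
      filter_upwards [hcoe, hVW] with y hy hVy
      rw [hy, hVy, weightedResolventKernel]
      linear_combination (weight (-1) x * freeResolventKernel s l x y * W y * f y) *
        weight_mul_weight_neg 1 y
    rw [integrable_congr hker, integral_congr_ae hker, integral_const_mul, ← hTx] at hx
    exact ⟨(integrable_const_mul_iff (IsUnit.mk0 _ (weight_ne_zero _ _)) _).1 hx.1,
      mul_left_cancel₀ (weight_ne_zero _ _) hx.2⟩
  · obtain ⟨-, -, ⟨B, hB, hBc⟩⟩ := keyW (-s)
    -- The operator `B` says nothing about convergence of the integral `R₀ g` where `V` vanishes.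
    -- The nowhere vanishing potential `(1+|x|)^{-4}`, which lies in every `L^r` with `1 ≤ r < ∞`,
    -- gives convergence at almost every `x`.
    obtain ⟨-, -, ⟨B₀, hB₀, -⟩⟩ := key (-s) (weight (-4)) (weight_continuous _).measurable
      (memLp_weight_neg_four hαr ENNReal.ofReal_ne_top)
      (memLp_weight_neg_four hα'r ENNReal.ofReal_ne_top)
      (memLp_weight_neg_four hpp'.symm.one_le hq)
    refine ⟨WeightedLp.conj 1 B, WeightedLp.isCompactOperator_conj hBc, fun g =>
      ⟨fun x => ∫ y, freeResolventKernel (-s) l x y * g y, ?_, ?_⟩⟩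
    all_goals
      have hker : ∀ (U : E3 → ℂ) (x : E3),
          (fun y => weightedResolventKernel (-s) l U y x * WeightedLp.toLpEquiv p' 1 g y)
            =ᵐ[volume] fun y => U x * weight 1 x * (freeResolventKernel (-s) l x y * g y) := by
        intro U x
        filter_upwards [WeightedLp.coeFn_toLpEquiv g] with y hy
        rw [hy, weightedResolventKernel, freeResolventKernel_comm (-s) l y x]
        linear_combination (freeResolventKernel (-s) l x y * (U x * weight 1 x) * g y) *
          weight_neg_mul_weight 1 y
    · filter_upwards [hB₀ (WeightedLp.toLpEquiv p' 1 g)] with x hx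
      rw [integrable_congr (hker _ x)] at hx
      exact ⟨(integrable_const_mul_iff (IsUnit.mk0 _ (mul_ne_zero (weight_ne_zero _ _)
        (weight_ne_zero _ _))) _).1 hx.1, rfl⟩
    · filter_upwards [hB (WeightedLp.toLpEquiv p' 1 g), WeightedLp.weight_mul_conj (A := B) g, hVW]
        with x hx hSx hVx
      have h := hx.2
      rw [integral_congr_ae (hker W x), integral_const_mul, ← hSx] at h
      refine mul_left_cancel₀ (weight_ne_zero 1 x) (h.trans ?_)
      rw [hVx]
      ring
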